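/- Let $0<q<1$. For $x,m,n\in\mathbb N$ let $$C_{x,m,n}=\bar p_{\min(m,n)}\big(q^{2x};q^{2|m-n|};q^2\big),\qquad \bar p_n(q^x;a;q)=(-1)^{n+x}\sqrt{\frac{(aq)^{x-n}(aq;q)_\infty(aq;q)_n}{(q;q)_n(q;q)_x}}\;{}_2\varphi_1\!\left(\begin{matrix}q^{-n},0\\aq\end{matrix};q,q^{x+1}\right)$$ be the Clebsch–Gordan coefficients (normalized Wall polynomials), and let $C_{x,m,n}=0$ if one of the integers $x,m,n$ is negative. Let $(e_m)_{m\in\mathbb N}$ be the standard basis of $\ell^2(\mathbb N)$, with $e_m=0$ for $m<0$. For $k\ge0$, $x\in\mathbb Z$, $\mathbf n\in\mathbb Z^{k+2}$ and $\mathbf r,\mathbf s\in\mathbb Z^k$, define the vectors $V^x_{\mathbf n;\mathbf r}$ and $W^x_{\mathbf n;\mathbf s}$ of $\ell^2(\mathbb N)^{\hat\otimes(k+2)}$, which belong to the binary trees with root $x$ and leaves $\mathbf n$ whose inner nodes $r_1,\dots,r_k$ hang (from top to bottom) on the right edge, respectively whose inner nodes $s_k,\dots,s_1$ hang (from top to bottom)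 on the left edge, as follows. For $k=0$ both are $\sum_{m_2-m_1=n_2-n_1}C_{x,m_1,m_2}\,e_{m_1}\otimes e_{m_2}$, and for $k\ge1$ $$V^x_{\mathbf n;\mathbf r}=\sum_{t\in\mathbb Z}C_{x,n_1+t,r_1+t}\;e_{n_1+t}\otimes V^{r_1+t}_{(n_2+t,n_3,\dots,n_{k+2});(r_2,\dots,r_k)},$$ $$W^x_{\mathbf n;\mathbf s}=\sum_{t\in\mathbb Z}C_{x,s_k+t,n_{k+2}+t}\;W^{s_k+t}_{(n_1,\dots,n_k,n_{k+1}+t);(s_1,\dots,s_{k-1})}\otimes e_{n_{k+2}+t}.$$ For $k\ge1$ the $3nj$-symbol is the coupling coefficient $R^{x,\mathbf n}_{\mathbf r,\mathbf s}=\langle V^x_{\mathbf n;\mathbf r},W^x_{\mathbf n;\mathbf s}\rangle$ if $x\ge0$; for $x<0$, where the vectors vanish, put $R^{x,\mathbf n}_{\mathbf r,\mathbf s}=R^{0,\mathbf n'}_{\mathbf r,\mathbf s}$ with $\mathbf n'=(n_1,n_2+x,\dots,n_{k+1}+x,n_{k+2})$. For $X\in\mathbb N$ and $p,\rho\in\mathbb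 Z$ put $$e^{1(23)}_{X,p,\rho}=\sum_{n-m+l=X-\rho}C_{X,n,n+p}C_{n+p,m,l}\,e_n\otimes e_m\otimes e_l,\qquad e^{(12)3}_{X,p,\rho}=\sum_{n-m+l=X-\rho}C_{X,l-p,l}C_{l-p,n,m}\,e_n\otimes e_m\otimes e_l$$ (sums over $n,m,l\in\mathbb N$). The $6j$-symbol is $$R^{x,n_1,n_2,n_3}_{p_1,p_2}=\big\langle e^{1(23)}_{X,p_1-n_1,\rho},e^{(12)3}_{X,n_3-p_2,\rho}\big\rangle,\qquad \rho=x-n_1+n_2-n_3,\quad X=\max(x,0).$$ **Theorem.** Let $x\in\mathbb Z$. (0) For $k\ge1$ all the vectors $V^x_{\mathbf n;\mathbf r}$, $W^x_{\mathbf n;\mathbf s}$ lie in $\ell^2(\mathbb N)^{\hat\otimes(k+2)}$, and the $3nj$-symbols are the expansion coefficients $$V^x_{\mathbf n;\mathbf r}=\sum_{\mathbf s\in\mathbb Z^k}R^{x,\mathbf n}_{\mathbf r,\mathbf s}\,W^x_{\mathbf n;\mathbf s}$$ (unconditional convergence in norm). (1) For $i=1,2$ let $k_i\ge1$, $\mathbf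 n_i\in\mathbb Z^{k_i+1}$ and $\mathbf r_i,\mathbf s_i\in\mathbb Z^{k_i}$. Let $k=k_1+k_2$, $\mathbf n=(\mathbf n_1,\mathbf n_2)$, $\mathbf r=(\mathbf r_1,\mathbf r_2)$, $\mathbf s=(\mathbf s_1,\mathbf s_2)$. Then $$R^{x,\mathbf n}_{\mathbf r,\mathbf s}=R^{x,(\mathbf n_1,r_{k_1+1})}_{\mathbf r_1,\mathbf s_1}\;R^{x,(s_{k_1},\mathbf n_2)}_{\mathbf r_2,\mathbf s_2}.$$ (2) Consequently, for all $k\ge1$, $\mathbf n\in\mathbb Z^{k+2}$ and $\mathbf r,\mathbf s\in\mathbb Z^k$, $$R^{x,\mathbf n}_{\mathbf r,\mathbf s}=\prod_{j=1}^kR^{x,s_{j-1},n_{j+1},r_{j+1}}_{r_j,s_j},\qquad s_0=n_1,\quad r_{k+1}=n_{k+2}.$$ -/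

import Mathlib

/-!
# Coupling coefficients for the quantum algebra of SU(2)

The Hilbert tensor product of `d` copies of `ℓ²(ℕ)` is realised as `ℓ²(ℕ^d)`, with
`e_{m₁} ⊗ ⋯ ⊗ e_{m_d}` the standard basis vector at `m = (m₁, …, m_d)`. A vector is given by its
function of coordinates `(Fin d → ℕ) → ℝ` (all coefficients that occur are real).
-/

namespace QSU2

noncomputable section

/-- The `q`-shifted factorial `(a;q)_n`. -/
def qPoch (a q : ℝ) (n : ℕ) : ℝ := ∏ i ∈ Finset.range n, (1 - a * q ^ i)

/-- The infinite `q`-shifted factorial `(a;q)_∞` (used for `0 < q < 1`). -/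
def qPochInf (a q : ℝ) : ℝ := ∏' i : ℕ, (1 - a * q ^ i)

/-- The Wall polynomial `p_n(y;a;q) = ₂φ₁(q^{-n}, 0; aq; q, qy)`; the series terminates. -/
def wall (q a : ℝ) (n : ℕ) (y : ℝ) : ℝ :=
  ∑ k ∈ Finset.range (n + 1),
    qPoch ((q ^ n)⁻¹) q k / (qPoch (a * q) q k * qPoch q q k) * (q * y) ^ k

/-- The normalised Wall function
`(-1)^{n+x} √((aq)^{x-n} (aq;q)_∞ (aq;q)_n / ((q;q)_n (q;q)_x)) p_n(q^x;a;q)`. -/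
def wallBar (q a : ℝ) (n x : ℕ) : ℝ :=
  (-1) ^ (n + x) *
    Real.sqrt ((a * q) ^ ((x : ℤ) - (n : ℤ)) * qPochInf (a * q) q * qPoch (a * q) q n /
      (qPoch q q n * qPoch q q x)) * wall q a n (q ^ x)

/-- The Clebsch-Gordan coefficient `C_{x,m,n}`, for all integers `x, m, n`; it vanishes if one of
them is negative. -/
def clebsch (q : ℝ) (x m n : ℤ) : ℝ :=
  if 0 ≤ x ∧ 0 ≤ m ∧ 0 ≤ n then
    if m ≤ n then wallBar (q ^ 2) (q ^ (2 * (n - m))) m.toNat x.toNat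
    else wallBar (q ^ 2) (q ^ (2 * (m - n))) n.toNat x.toNat
  else 0

/-! ### Threefold tensor products and `6j`-symbols -/

/-- The vector
`e^{1(23)}_{x,p,r} = ∑_{n-m+k=x-r} C_{x,n,n+p} C_{n+p,m,k} e_n ⊗ e_m ⊗ e_k`. -/
def vecRight (q : ℝ) (x p r : ℤ) (m : Fin 3 → ℕ) : ℝ :=
  if (m 0 : ℤ) - m 1 + m 2 = x - r then
    clebsch q x (m 0) (m 0 + p) * clebsch q (m 0 + p) (m 1) (m 2)
  else 0

/-- The vector
`e^{(12)3}_{x,p,r} = ∑_{n-m+k=x-r} C_{x,k-p,k} C_{k-p,n,m} e_n ⊗ e_m ⊗ e_k`. -/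
def vecLeft (q : ℝ) (x p r : ℤ) (m : Fin 3 → ℕ) : ℝ :=
  if (m 0 : ℤ) - m 1 + m 2 = x - r then
    clebsch q x (m 2 - p) (m 2) * clebsch q (m 2 - p) (m 0) (m 1)
  else 0

/-- The Racah coefficient `R^x_{p₁,r₁;p₂,r₂} = ⟨e^{1(23)}_{x,p₁,r₁}, e^{(12)3}_{x,p₂,r₂}⟩`,
`x ∈ ℕ`. -/
def racah (q : ℝ) (x : ℕ) (p₁ r₁ p₂ r₂ : ℤ) : ℝ :=
  ∑' m : Fin 3 → ℕ, vecRight q x p₁ r₁ m * vecLeft q x p₂ r₂ m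

/-- The `6j`-symbol `R^{x,n₁,n₂,n₃}_{p₁,p₂}` in tree labels: the Racah coefficient
`R_{p₁-n₁,ρ;n₃-p₂,ρ}` with `ρ = x - n₁ + n₂ - n₃`. A Racah coefficient does not depend on its upper
index; here that index is `x` if `x ≥ 0`, and `0` if the label `x` is negative. -/
def sixJ (q : ℝ) (x n₁ n₂ n₃ p₁ p₂ : ℤ) : ℝ :=
  racah q x.toNat (p₁ - n₁) (x - n₁ + n₂ - n₃) (n₃ - p₂) (x - n₁ + n₂ - n₃)

/-! ### Binary trees and `3nj`-symbols -/

/-- The vector of the binary tree with root `x` and leaves `n` all of whose inner nodes `r` hang on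
the right edge (`x` has children `n₁` and `r₁`, `r₁` has children `n₂` and `r₂`, …, the last inner
node has children `n_{k+1}` and `n_{k+2}`). For `k = 0` it is
`e^{12}_{x,n₂-n₁} = ∑_{m₂-m₁=n₂-n₁} C_{x,m₁,m₂} e_{m₁} ⊗ e_{m₂}`, and in general it is
`∑_t C_{x,n₁+t,r₁+t} e_{n₁+t} ⊗ v_t`, where `v_t` is the vector of the subtree at `r₁` with its root
`r₁` and its first leaf `n₂` both raised by `t`. -/
def treeRight (q : ℝ) : (k : ℕ) → ℤ → (Fin (k + 2) → ℤ) → (Fin k → ℤ) → (Fin (k + 2) → ℕ) → ℝ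
  | 0, x, n, _, m =>
      if (m 1 : ℤ) - m 0 = n 1 - n 0 then clebsch q x (m 0) (m 1) else 0
  | k + 1, x, n, r, m =>
      let t : ℤ := (m 0 : ℤ) - n 0
      clebsch q x (m 0) (r 0 + t) *
        treeRight q k (r 0 + t) (Fin.tail n + Pi.single 0 t) (Fin.tail r) (Fin.tail m)

/-- The vector of the binary tree with root `x` and leaves `n` all of whose inner nodes `s` hang on
the left edge (`x` has children `s_k` and `n_{k+2}`, `s_k` has children `s_{k-1}` and `n_{k+1}`, …,
`s₁` has children `n₁` and `n₂`). In general it is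
`∑_t C_{x,s_k+t,n_{k+2}+t} w_t ⊗ e_{n_{k+2}+t}`, where `w_t` is the vector of the subtree at `s_k`
with its root `s_k` and its last leaf `n_{k+1}` both raised by `t`. -/
def treeLeft (q : ℝ) : (k : ℕ) → ℤ → (Fin (k + 2) → ℤ) → (Fin k → ℤ) → (Fin (k + 2) → ℕ) → ℝ
  | 0, x, n, _, m =>
      if (m 1 : ℤ) - m 0 = n 1 - n 0 then clebsch q x (m 0) (m 1) else 0
  | k + 1, x, n, s, m =>
      let t : ℤ := (m (Fin.last (k + 2)) : ℤ) - n (Fin.last (k + 2))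
      clebsch q x (s (Fin.last k) + t) (m (Fin.last (k + 2))) *
        treeLeft q k (s (Fin.last k) + t) (Fin.init n + Pi.single (Fin.last (k + 1)) t)
          (Fin.init s) (Fin.init m)

/-- Add `t` to all leaves except the first and the last one. -/
def raiseInner (k : ℕ) (t : ℤ) (n : Fin (k + 2) → ℤ) : Fin (k + 2) → ℤ :=
  fun j => if j = 0 ∨ j = Fin.last (k + 1) then n j else n j + t

/-- The `3nj`-symbol `R^{x,n}_{r,s}`, the coupling coefficient
`⟨treeRight x n r, treeLeft x n s⟩`, if `x ≥ 0`. It does not change if `x` is raised by `1` and all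
inner leaves are lowered by `1` (for `k = 1` this is the independence of the Racah coefficients of
their upper index); for a label `x < 0`, where both vectors vanish, it is defined by this rule from
its values at the root label `0`. -/
def threeNJ (q : ℝ) (k : ℕ) (x : ℤ) (n : Fin (k + 2) → ℤ) (r s : Fin k → ℤ) : ℝ :=
  ∑' m : Fin (k + 2) → ℕ,
    treeRight q k (x.toNat : ℤ) (raiseInner k (x - x.toNat) n) r m *
      treeLeft q k (x.toNat : ℤ) (raiseInner k (x - x.toNat) n) s m

/-- Concatenation `(n₁, n₂)` of two lists of leaves. -/
def joinLeaves {k₁ k₂ : ℕ} (n₁ : Fin (k₁ + 1) → ℤ) (n₂ : Fin (k₂ + 1) → ℤ) :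
    Fin (k₁ + k₂ + 2) → ℤ :=
  fun j => Fin.append n₁ n₂ (Fin.cast (by omega) j)

end

end QSU2

namespace QSU2

open Finset

variable {q : ℝ}

/-! ### `q`-shifted factorials -/

/-! The theorem rests on one recoupling step. In the left tree the two lowest leaves `n₁, n₂` form a
node `s₁`. Pairing the right tree with this node alone leaves a sum over the first coordinate, with
only three Clebsch-Gordan factors (`coupling`). As a function of the label `a` at `s₁` and the label
`c` at the right child of `r₁`, this sum satisfies the same two contiguous relations as `C_{x,a,c}`.
On a line `c - a = const` these relations determine a solution from one boundary value, so the sum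
is a constant times `C_{x,a,c}` (`exists_coupling_eq`). What remains is the inner product of two
smaller trees in which `n₁, n₂` are replaced by the single leaf `s₁`. For three leaves the smaller
inner product is `1`, so the constant is a `6j`-symbol (`coupling_eq_sixJ`). Iteration gives the
product of `6j`-symbols (`treeInner_eq_prod`), and cutting this product in two gives the
factorization.

The contiguous relations come from a terminating sum for `C_{x,m,n}` that is symmetric in `m` and
`n`, obtained by reversing the Wall series (`clebsch_eq`). They give multiplication by `q^x`, and
raising and lowering of `x`, in terms of shifts of `m` and `n`. Negative labels contribute zero and
`root q 0 = 0`, so the relations hold for all integers; this is why the trees are studied on integer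
tuples, where summation indices can be shifted freely.

For fixed `n - m` the coefficients form an orthogonal matrix in `x` and `m`. Orthonormality in `x`
starts from the `q`-binomial theorem at `m = 0` and proceeds by recursion (`hasSum_clebsch_root`).
Orthonormality in `m` follows because multiplication by `q^{2x}` separates the values of `x`
(`hasSum_clebsch_leaf`).

For the expansion, the left tree vectors are orthonormal (`hasSum_intLeft_mul`), the right tree
vector has norm `1`, and the squares of its coefficients add up to `1`. The last fact reduces to one
`6j`-symbol through the product formula (`hasSum_sixJ_sq`). Equality in Bessel's inequality then
forces convergence to the right tree vector (`hasSum_of_parseval`). A negative root label makes the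
vectors zero and changes each `6j`-symbol only by a relabelling. -/

/-- `(q²;q²)_n`, extended by `1` to negative indices. -/
noncomputable def qFac (q : ℝ) (n : ℤ) : ℝ := qPoch (q ^ 2) (q ^ 2) n.toNat

/-- `1 / (q²;q²)_n`, which vanishes for negative `n`. -/
noncomputable def invFac (q : ℝ) (n : ℤ) : ℝ := if 0 ≤ n then (qFac q n)⁻¹ else 0

/-- `√(1 - q^{2n})`. -/
noncomputable def root (q : ℝ) (n : ℤ) : ℝ := Real.sqrt (1 - q ^ (2 * n))

theorem qPoch_succ (a q : ℝ) (n : ℕ) : qPoch a q (n + 1) = qPoch a q n * (1 - a * q ^ n) :=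
  prod_range_succ _ _

theorem one_sub_zpow_pos (hq0 : 0 < q) (hq1 : q < 1) {n : ℤ} (hn : 0 < n) :
    0 < 1 - q ^ (2 * n) := by
  have : q ^ (2 * n) < 1 := (zpow_lt_one_iff_right_of_lt_one₀ hq0 hq1).2 (by omega)
  linarith

theorem one_sub_zpow_nonneg (hq0 : 0 < q) (hq1 : q < 1) {n : ℤ} (hn : 0 ≤ n) :
    0 ≤ 1 - q ^ (2 * n) := by
  rcases hn.eq_or_lt with rfl | h
  · simp
  · exact (one_sub_zpow_pos hq0 hq1 h).le

theorem root_zero : root q 0 = 0 := by simp [root]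

theorem root_pos (hq0 : 0 < q) (hq1 : q < 1) {n : ℤ} (hn : 0 < n) : 0 < root q n :=
  Real.sqrt_pos.2 (one_sub_zpow_pos hq0 hq1 hn)

theorem root_nonneg (n : ℤ) : 0 ≤ root q n := Real.sqrt_nonneg _

theorem root_le_one (hq0 : 0 < q) (n : ℤ) : root q n ≤ 1 := by
  rw [root, Real.sqrt_le_one]
  have := zpow_pos hq0 (2 * n)
  linarith

theorem root_sq (hq0 : 0 < q) (hq1 : q < 1) {n : ℤ} (hn : 0 ≤ n) :
    root q n * root q n = 1 - q ^ (2 * n) :=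
  Real.mul_self_sqrt (one_sub_zpow_nonneg hq0 hq1 hn)

theorem qFac_zero : qFac q 0 = 1 := by simp [qFac, qPoch]

theorem qFac_add_one {n : ℤ} (hn : 0 ≤ n) :
    qFac q (n + 1) = qFac q n * (1 - q ^ (2 * (n + 1))) := by
  lift n to ℕ using hn
  have h1 : ((n : ℤ) + 1).toNat = n + 1 := by omega
  have h2 : (q : ℝ) ^ (2 * ((n : ℤ) + 1)) = q ^ 2 * (q ^ 2) ^ n := by
    rw [show (2 * ((n : ℤ) + 1)) = ((2 + 2 * n : ℕ) : ℤ) by push_cast; ring, zpow_natCast,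
      pow_add, pow_mul]
  rw [qFac, h1, qPoch_succ, h2, qFac, Int.toNat_natCast]

theorem qFac_pos (hq0 : 0 < q) (hq1 : q < 1) (n : ℤ) : 0 < qFac q n := by
  rw [qFac, qPoch]
  refine Finset.prod_pos fun i _ => ?_
  have : (q ^ 2) * (q ^ 2) ^ i < 1 := by
    rw [← pow_succ', ← pow_mul]
    exact pow_lt_one₀ hq0.le hq1 (by omega)
  linarith

theorem invFac_of_neg {n : ℤ} (hn : n < 0) : invFac q n = 0 := by
  rw [invFac, if_neg (by omega)]

theorem invFac_of_nonneg {n : ℤ} (hn : 0 ≤ n) : invFac q n = (qFac q n)⁻¹ := if_pos hn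

/-- At `n = 0` the factor vanishes together with the right side. Having no boundary case here makes
termwise manipulation of the terminating sums uniform. -/
theorem one_sub_mul_invFac (hq0 : 0 < q) (hq1 : q < 1) (n : ℤ) :
    (1 - q ^ (2 * n)) * invFac q n = invFac q (n - 1) := by
  rcases lt_trichotomy n 0 with h | rfl | h
  · rw [invFac_of_neg h, invFac_of_neg (by omega), mul_zero]
  · rw [invFac_of_neg (show (0 : ℤ) - 1 < 0 by norm_num)]; simp
  · rw [invFac_of_nonneg h.le, invFac_of_nonneg (by omega)]
    have := qFac_add_one (q := q) (n := n - 1) (by omega)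
    rw [sub_add_cancel] at this
    have h1 := one_sub_zpow_pos hq0 hq1 h
    have h2 := qFac_pos hq0 hq1 (n - 1)
    rw [this]
    field_simp

/-- `√(q²;q²)_n`. -/
noncomputable def sqrtFac (q : ℝ) (n : ℤ) : ℝ := Real.sqrt (qFac q n)

theorem sqrtFac_pos (hq0 : 0 < q) (hq1 : q < 1) (n : ℤ) : 0 < sqrtFac q n :=
  Real.sqrt_pos.2 (qFac_pos hq0 hq1 n)

theorem sqrtFac_mul_self (hq0 : 0 < q) (hq1 : q < 1) (n : ℤ) :
    sqrtFac q n * sqrtFac q n = qFac q n :=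
  Real.mul_self_sqrt (qFac_pos hq0 hq1 n).le

theorem sqrtFac_add_one (hq0 : 0 < q) (hq1 : q < 1) {n : ℤ} (hn : 0 ≤ n) :
    sqrtFac q (n + 1) = sqrtFac q n * root q (n + 1) := by
  rw [sqrtFac, qFac_add_one hn, Real.sqrt_mul (qFac_pos hq0 hq1 n).le]; rfl

theorem root_mul_sqrtFac (hq0 : 0 < q) (hq1 : q < 1) {n : ℤ} (hn : 0 ≤ n) :
    root q (n + 1) * sqrtFac q (n + 1) = (1 - q ^ (2 * (n + 1))) * sqrtFac q n := by
  rw [sqrtFac_add_one hq0 hq1 hn, ← root_sq hq0 hq1 (by omega : 0 ≤ n + 1)]; ring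

theorem qPoch_shift (hq0 : 0 < q) (hq1 : q < 1) (p k : ℕ) :
    qPoch ((q ^ 2) ^ (p + 1)) (q ^ 2) k = qFac q (p + k : ℕ) / qFac q p := by
  induction k with
  | zero => simp [qPoch, (qFac_pos hq0 hq1 p).ne']
  | succ k ih =>
    have := qFac_add_one (q := q) (n := (p + k : ℕ)) (by omega)
    rw [qPoch_succ, ih, show ((p + (k + 1) : ℕ) : ℤ) = ((p + k : ℕ) : ℤ) + 1 by push_cast; ring,
      this, show 2 * (((p + k : ℕ) : ℤ) + 1) = ((2 * (p + k + 1) : ℕ) : ℤ) by push_cast; ring,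
      zpow_natCast]
    ring

/-! ### Infinite `q`-products -/

theorem multipliable_qPochInf (hq0 : 0 < q) (hq1 : q < 1) (a : ℝ) :
    Multipliable fun i : ℕ => (1 - a * q ^ i) := by
  have : Summable fun i : ℕ => ‖-(a * q ^ i)‖ := by
    simp only [norm_neg, norm_mul]
    refine Summable.mul_left _ ?_
    simp only [norm_pow]
    exact summable_geometric_of_lt_one (norm_nonneg _) (by rwa [Real.norm_of_nonneg hq0.le])
  simpa [sub_eq_add_neg] using multipliable_one_add_of_summable this

theorem qPochInf_eq_mul (hq0 : 0 < q) (hq1 : q < 1) (a : ℝ) :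
    qPochInf a q = (1 - a) * qPochInf (a * q) q := by
  have h := (multipliable_qPochInf hq0 hq1 (a * q))
  have h' : ∀ b : ℕ, (1 - a * q * q ^ b) = 1 - a * q ^ (b + 1) := fun b => by ring
  rw [qPochInf, tprod_eq_zero_mul' (f := fun i : ℕ => 1 - a * q ^ i)
    (by simpa only [h'] using h), qPochInf]
  simp only [h', pow_zero, mul_one]

/-- The logarithms of the factors are summable, so the product is an exponential. -/
theorem qPochInf_pos (hq0 : 0 < q) (hq1 : q < 1) {a : ℝ} (ha0 : 0 ≤ a) (ha : a < 1) :
    0 < qPochInf a q := by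
  have hlt : ∀ i : ℕ, a * q ^ i < 1 := fun i =>
    (mul_le_of_le_one_right ha0 (pow_le_one₀ hq0.le hq1.le)).trans_lt ha
  have hs : Summable fun i : ℕ => Real.log (1 - a * q ^ i) := by
    have : Summable fun i : ℕ => -(a * q ^ i) :=
      ((summable_geometric_of_lt_one hq0.le hq1).mul_left a).neg
    simpa [sub_eq_add_neg] using Real.summable_log_one_add_of_summable this
  rw [qPochInf, ← Real.rexp_tsum_eq_tprod (fun i => by linarith [hlt i]) hs]
  exact Real.exp_pos _

theorem qPochInf_shift (hq0 : 0 < q) (hq1 : q < 1) (p : ℕ) :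
    qPochInf ((q ^ 2) ^ (p + 1)) (q ^ 2) = qPochInf (q ^ 2) (q ^ 2) / qFac q p := by
  have h0 : 0 < q ^ 2 := by positivity
  have h1 : q ^ 2 < 1 := pow_lt_one₀ hq0.le hq1 (by norm_num)
  induction p with
  | zero => simp [qFac_zero]
  | succ p ih =>
    have h := qPochInf_eq_mul h0 h1 ((q ^ 2) ^ (p + 1))
    have h2 := one_sub_zpow_pos hq0 hq1 (n := (p : ℤ) + 1) (by omega)
    have h3 := qFac_pos hq0 hq1 p
    have h4 : (q : ℝ) ^ (2 * ((p : ℤ) + 1)) = (q ^ 2) ^ (p + 1) := by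
      rw [show (2 * ((p : ℤ) + 1)) = ((2 * (p + 1) : ℕ) : ℤ) by push_cast; ring, zpow_natCast,
        pow_mul]
    rw [ih, ← pow_succ] at h
    rw [show ((p + 1 : ℕ) : ℤ) = (p : ℤ) + 1 by push_cast; ring, qFac_add_one (by omega)]
    rw [h4] at h2 ⊢
    rw [div_mul_eq_div_div, h, mul_div_cancel_left₀ _ h2.ne']

/-- Each factor is `1 - q^{-2(m-i)} = -q^{-2(m-i)} (1 - q^{2(m-i)})`; the extracted powers add up to
the exponent `k(k-1) - 2mk`. -/
theorem qPoch_inv (hq0 : 0 < q) (hq1 : q < 1) (m k : ℕ) (hk : k ≤ m) :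
    qPoch (((q ^ 2) ^ m)⁻¹) (q ^ 2) k =
      qFac q m / qFac q ((m : ℤ) - k) * (-1) ^ k * q ^ ((k : ℤ) * (k - 1) - 2 * m * k) := by
  induction k with
  | zero => simp [qPoch, (qFac_pos hq0 hq1 m).ne']
  | succ k ih =>
    have h := qFac_add_one (q := q) (n := (m : ℤ) - (k + 1)) (by omega)
    rw [show (m : ℤ) - (k + 1) + 1 = m - k by ring] at h
    have h2 := one_sub_zpow_pos hq0 hq1 (n := (m : ℤ) - k) (by omega)
    have h3 := qFac_pos hq0 hq1 ((m : ℤ) - (k + 1))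
    have e1 : ((q ^ 2) ^ m)⁻¹ * (q ^ 2) ^ k = q ^ (-(2 * ((m : ℤ) - k))) := by
      rw [← pow_mul, ← pow_mul, ← zpow_natCast, ← zpow_natCast, ← zpow_neg, ← zpow_add₀ hq0.ne']
      congr 1; push_cast; ring
    have e2 : (q : ℝ) ^ (((k + 1 : ℕ) : ℤ) * ((k + 1 : ℕ) - 1) - 2 * m * (k + 1 : ℕ)) =
        q ^ ((k : ℤ) * (k - 1) - 2 * m * k) * q ^ (-(2 * ((m : ℤ) - k))) := by
      rw [← zpow_add₀ hq0.ne']; congr 1; push_cast; ring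
    rw [qPoch_succ, ih (by omega), h, e1, e2, zpow_neg]
    push_cast
    have h4 := zpow_pos hq0 (2 * ((m : ℤ) - k))
    field_simp
    ring

end QSU2

namespace QSU2

open Finset

variable {q : ℝ}

/-! ### A symmetric formula for the Clebsch-Gordan coefficients -/

/-- The weight `(-1)^j q^{j(j-1)-2xj} / (q²;q²)_j`. -/
noncomputable def cgWeight (q : ℝ) (x : ℤ) (j : ℕ) : ℝ :=
  (-1) ^ j * q ^ ((j : ℤ) * j - j - 2 * x * j) * invFac q j

/-- The first `N` terms of the symmetric sum for the Clebsch-Gordan coefficients. -/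
noncomputable def cgSum (q : ℝ) (N : ℕ) (x m n : ℤ) : ℝ :=
  ∑ j ∈ range N, cgWeight q x j * (invFac q (m - j) * invFac q (n - j))

/-! ### Shift identities for the symmetric sum -/

theorem cgWeight_succ (hq0 : 0 < q) (hq1 : q < 1) (x : ℤ) (j : ℕ) :
    cgWeight q x (j + 1) * (1 - q ^ (2 * ((j : ℤ) + 1))) =
      -(cgWeight q x j * q ^ (2 * j - 2 * x)) := by
  have h := one_sub_mul_invFac hq0 hq1 ((j : ℤ) + 1)
  rw [add_sub_cancel_right] at h
  have e : (q : ℝ) ^ (((j + 1 : ℕ) : ℤ) * (j + 1 : ℕ) - (j + 1 : ℕ) - 2 * x * (j + 1 : ℕ)) =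
      q ^ ((j : ℤ) * j - j - 2 * x * j) * q ^ (2 * j - 2 * x) := by
    rw [← zpow_add₀ hq0.ne']; congr 1; push_cast; ring
  rw [cgWeight, e, cgWeight, ← h]
  push_cast
  ring

theorem cgWeight_sub_one (hq0 : 0 < q) (x : ℤ) (j : ℕ) :
    cgWeight q (x - 1) j = cgWeight q x j * q ^ (2 * (j : ℤ)) := by
  have e : (q : ℝ) ^ ((j : ℤ) * j - j - 2 * (x - 1) * j) =
      q ^ ((j : ℤ) * j - j - 2 * x * j) * q ^ (2 * (j : ℤ)) := by
    rw [← zpow_add₀ hq0.ne']; congr 1; ring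
  rw [cgWeight, e, cgWeight]
  ring

/-- The factor `1 - q^{2j}` kills the term `j = 0` and cancels the last factor of `(q²;q²)_j` in the
others, so the index can be shifted by one. All relations for `cgSum` below that change its
parameters come from this shift. -/
theorem sum_cgWeight_mul (hq0 : 0 < q) (hq1 : q < 1) (x : ℤ) (N : ℕ) (f : ℕ → ℝ) :
    ∑ j ∈ range (N + 1), cgWeight q x j * (1 - q ^ (2 * (j : ℤ))) * f j =
      -∑ j ∈ range N, cgWeight q x j * q ^ (2 * j - 2 * x) * f (j + 1) := by
  rw [sum_range_succ']
  simp only [Nat.cast_zero, mul_zero, zpow_zero, sub_self, zero_mul, add_zero]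
  rw [← sum_neg_distrib]
  refine sum_congr rfl fun j _ => ?_
  rw [Nat.cast_succ, cgWeight_succ hq0 hq1]
  ring

theorem cgSum_comm (N : ℕ) (x m n : ℤ) : cgSum q N x m n = cgSum q N x n m :=
  sum_congr rfl fun j _ => by ring

theorem cgSum_succ {N : ℕ} {m : ℤ} (h : m < N) (x n : ℤ) :
    cgSum q (N + 1) x m n = cgSum q N x m n := by
  rw [cgSum, sum_range_succ, invFac_of_neg (by omega : m - N < 0)]
  simp [cgSum]

theorem cgSum_of_neg_left {m : ℤ} (h : m < 0) (N : ℕ) (x n : ℤ) : cgSum q N x m n = 0 :=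
  sum_eq_zero fun j _ => by rw [invFac_of_neg (by omega : m - j < 0)]; ring

/-- Over the common denominator the two terms on the left differ by the factor `q^{2(n+1)} -
q^{2(n+1-j)} = -q^{2(n+1-j)} (1 - q^{2j})`, to which the index shift applies. -/
theorem cgSum_contiguous_right (hq0 : 0 < q) (hq1 : q < 1) (N : ℕ) (x m n : ℤ) :
    cgSum q (N + 1) x m n - (1 - q ^ (2 * (n + 1))) * cgSum q (N + 1) x m (n + 1) =
      q ^ (2 * n - 2 * x) * cgSum q N x (m - 1) n := by
  have h := sum_cgWeight_mul hq0 hq1 x N fun j =>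
    -(invFac q (m - j) * (q ^ (2 * (n + 1 - j)) * invFac q (n + 1 - j)))
  rw [cgSum, cgSum, cgSum, mul_sum, mul_sum, ← sum_sub_distrib]
  convert h using 1
  · refine sum_congr rfl fun j _ => ?_
    have h1 := one_sub_mul_invFac hq0 hq1 (n + 1 - j)
    have e : (q : ℝ) ^ (2 * (n + 1)) = q ^ (2 * (n + 1 - j)) * q ^ (2 * (j : ℤ)) := by
      rw [← zpow_add₀ hq0.ne']; congr 1; ring
    rw [show n + 1 - (j : ℤ) - 1 = n - j by ring] at h1
    rw [← h1, e]
    ring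
  · rw [← sum_neg_distrib]
    refine sum_congr rfl fun j _ => ?_
    have e : (q : ℝ) ^ (2 * n - 2 * x) =
        q ^ (2 * (j : ℤ) - 2 * x) * q ^ (2 * (n + 1 - (j + 1 : ℕ))) := by
      rw [← zpow_add₀ hq0.ne']; congr 1; push_cast; ring
    rw [e, show n + 1 - ((j + 1 : ℕ) : ℤ) = n - j by push_cast; ring,
      show m - ((j + 1 : ℕ) : ℤ) = m - 1 - j by push_cast; ring]
    ring

theorem cgSum_raise (hq0 : 0 < q) (hq1 : q < 1) (N : ℕ) (x m n : ℤ) :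
    cgSum q (N + 1) x m n - cgSum q (N + 1) (x + 1) m n =
      q ^ (-2 * x - 2) * cgSum q N x (m - 1) (n - 1) := by
  have h := sum_cgWeight_mul hq0 hq1 (x + 1) N fun j => -(invFac q (m - j) * invFac q (n - j))
  rw [cgSum, cgSum, cgSum, mul_sum, ← sum_sub_distrib]
  have hw : ∀ j : ℕ, cgWeight q x j = cgWeight q (x + 1) j * q ^ (2 * (j : ℤ)) := fun j => by
    rw [← cgWeight_sub_one hq0, add_sub_cancel_right]
  convert h using 1
  · refine sum_congr rfl fun j _ => ?_
    rw [hw]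
    ring
  · rw [← sum_neg_distrib]
    refine sum_congr rfl fun j _ => ?_
    have e : (q : ℝ) ^ (2 * (j : ℤ) - 2 * (x + 1)) = q ^ (-2 * x - 2) * q ^ (2 * (j : ℤ)) := by
      rw [← zpow_add₀ hq0.ne']; congr 1; ring
    rw [e, hw, show n - ((j + 1 : ℕ) : ℤ) = n - 1 - j by push_cast; ring,
      show m - ((j + 1 : ℕ) : ℤ) = m - 1 - j by push_cast; ring]
    ring

theorem cgSum_lower (hq0 : 0 < q) (hq1 : q < 1) (N : ℕ) (x m n : ℤ) (hm : m < N) :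
    (1 - q ^ (2 * (m + 1))) * (1 - q ^ (2 * (n + 1))) * q ^ (2 * x) *
        cgSum q (N + 1) x (m + 1) (n + 1) - q ^ (2 * (m + n + 1)) * cgSum q N x m n =
      -((1 - q ^ (2 * x)) * cgSum q N (x - 1) m n) := by
  -- With `A = q^{2(m+1-j)}`, `B = q^{2(n+1-j)}`, `Q = q^{2j}`, the test function comes from
  -- `(1-AQ)(1-BQ) = (1-A)(1-B) + (1-Q)(A + B - AB(1+Q))`.
  have h := sum_cgWeight_mul hq0 hq1 x N fun j => q ^ (2 * x) *
    (invFac q (m + 1 - j) * invFac q (n + 1 - j) * (q ^ (2 * (m + 1 - j)) + q ^ (2 * (n + 1 - j)) -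
      q ^ (2 * (m + 1 - j)) * q ^ (2 * (n + 1 - j)) * (1 + q ^ (2 * (j : ℤ)))))
  have h' := sum_cgWeight_mul hq0 hq1 x N fun j =>
    q ^ (2 * x) * (invFac q (m - j) * invFac q (n - j))
  have h1 : (1 - q ^ (2 * (m + 1))) * (1 - q ^ (2 * (n + 1))) * q ^ (2 * x) *
      cgSum q (N + 1) x (m + 1) (n + 1) = q ^ (2 * x) * cgSum q (N + 1) x m n +
      -∑ j ∈ range N, cgWeight q x j * q ^ (2 * j - 2 * x) * (q ^ (2 * x) *
        (invFac q (m + 1 - (j + 1 : ℕ)) * invFac q (n + 1 - (j + 1 : ℕ)) *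
          (q ^ (2 * (m + 1 - (j + 1 : ℕ))) + q ^ (2 * (n + 1 - (j + 1 : ℕ))) -
          q ^ (2 * (m + 1 - (j + 1 : ℕ))) * q ^ (2 * (n + 1 - (j + 1 : ℕ))) *
            (1 + q ^ (2 * ((j + 1 : ℕ) : ℤ)))))) := by
    rw [← h, cgSum, cgSum, mul_sum, mul_sum, ← sum_add_distrib]
    refine sum_congr rfl fun j _ => ?_
    have h1 := one_sub_mul_invFac hq0 hq1 (n + 1 - j)
    have e1 : (q : ℝ) ^ (2 * (n + 1)) = q ^ (2 * (n + 1 - j)) * q ^ (2 * (j : ℤ)) := by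
      rw [← zpow_add₀ hq0.ne']; congr 1; ring
    rw [show n + 1 - (j : ℤ) - 1 = n - j by ring] at h1
    have h2 := one_sub_mul_invFac hq0 hq1 (m + 1 - j)
    have e2 : (q : ℝ) ^ (2 * (m + 1)) = q ^ (2 * (m + 1 - j)) * q ^ (2 * (j : ℤ)) := by
      rw [← zpow_add₀ hq0.ne']; congr 1; ring
    rw [show m + 1 - (j : ℤ) - 1 = m - j by ring] at h2
    rw [← h1, ← h2, e1, e2]
    ring
  have h2 : ∑ j ∈ range N, cgWeight q x j * q ^ (2 * (j : ℤ)) *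
      (invFac q (m - j - 1) * invFac q (n - j - 1)) =
      -(q ^ (2 * x) * ∑ j ∈ range N, cgWeight q x j * (1 - q ^ (2 * (j : ℤ))) *
        (invFac q (m - j) * invFac q (n - j))) := by
    rw [sum_range_succ, invFac_of_neg (by omega : m - N < 0)] at h'
    simp only [zero_mul, mul_zero, add_zero] at h'
    rw [mul_sum]
    have : ∀ j ∈ range N, q ^ (2 * x) * (cgWeight q x j * (1 - q ^ (2 * (j : ℤ))) *
        (invFac q (m - j) * invFac q (n - j))) = cgWeight q x j * (1 - q ^ (2 * (j : ℤ))) *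
        (q ^ (2 * x) * (invFac q (m - j) * invFac q (n - j))) := fun j _ => by ring
    rw [sum_congr rfl this, h', neg_neg]
    refine sum_congr rfl fun j _ => ?_
    have e : (q : ℝ) ^ (2 * (j : ℤ)) = q ^ (2 * (j : ℤ) - 2 * x) * q ^ (2 * x) := by
      rw [← zpow_add₀ hq0.ne']; congr 1; ring
    rw [e, show n - ((j + 1 : ℕ) : ℤ) = n - j - 1 by push_cast; ring,
      show m - ((j + 1 : ℕ) : ℤ) = m - j - 1 by push_cast; ring]
    ring
  -- After the shift, with `A = q^{2(m-j)}`, `B = q^{2(n-j)}` and `Q = q^{2(j+1)}`, the bracket is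
  -- `1 - (1-A)(1-B) - ABQ`; its three parts give the three sums. The one with `(1-A)(1-B)` is
  -- shifted back by `h2`.
  have h3 : ∑ j ∈ range N, cgWeight q x j * q ^ (2 * j - 2 * x) * (q ^ (2 * x) *
        (invFac q (m + 1 - (j + 1 : ℕ)) * invFac q (n + 1 - (j + 1 : ℕ)) *
          (q ^ (2 * (m + 1 - (j + 1 : ℕ))) + q ^ (2 * (n + 1 - (j + 1 : ℕ))) -
          q ^ (2 * (m + 1 - (j + 1 : ℕ))) * q ^ (2 * (n + 1 - (j + 1 : ℕ))) *
            (1 + q ^ (2 * ((j + 1 : ℕ) : ℤ)))))) =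
      cgSum q N (x - 1) m n - q ^ (2 * (m + n + 1)) * cgSum q N x m n -
      ∑ j ∈ range N, cgWeight q x j * q ^ (2 * (j : ℤ)) *
      (invFac q (m - j - 1) * invFac q (n - j - 1)) := by
    rw [cgSum, cgSum, mul_sum, ← sum_sub_distrib, ← sum_sub_distrib]
    refine sum_congr rfl fun j _ => ?_
    rw [← one_sub_mul_invFac hq0 hq1, ← one_sub_mul_invFac hq0 hq1, cgWeight_sub_one hq0,
      show n + 1 - ((j + 1 : ℕ) : ℤ) = n - j by push_cast; ring,
      show m + 1 - ((j + 1 : ℕ) : ℤ) = m - j by push_cast; ring]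
    have e : (q : ℝ) ^ (2 * (j : ℤ)) = q ^ (2 * (j : ℤ) - 2 * x) * q ^ (2 * x) := by
      rw [← zpow_add₀ hq0.ne']; congr 1; ring
    have e1 : (q : ℝ) ^ (2 * (m + n + 1)) = q ^ (2 * (j : ℤ) - 2 * x) * q ^ (2 * x) *
        (q ^ (2 * (m - j)) * q ^ (2 * (n - j)) * q ^ (2 * ((j + 1 : ℕ) : ℤ))) := by
      rw [← zpow_add₀ hq0.ne', ← zpow_add₀ hq0.ne', ← zpow_add₀ hq0.ne', ← zpow_add₀ hq0.ne']
      congr 1; push_cast; ring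
    rw [e, e1]
    ring
  rw [h1, h3, h2, cgSum_succ hm, cgSum, cgSum]
  have h4 : ∑ j ∈ range N, cgWeight q x j * (1 - q ^ (2 * (j : ℤ))) *
      (invFac q (m - j) * invFac q (n - j)) = ∑ j ∈ range N, cgWeight q x j *
      (invFac q (m - j) * invFac q (n - j)) - ∑ j ∈ range N, cgWeight q (x - 1) j *
      (invFac q (m - j) * invFac q (n - j)) := by
    rw [← sum_sub_distrib]
    refine sum_congr rfl fun j _ => ?_
    rw [cgWeight_sub_one hq0]
    ring
  rw [h4]
  ring

/-! ### The Clebsch-Gordan coefficients as symmetric sums -/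

theorem clebsch_comm (x m n : ℤ) : clebsch q x m n = clebsch q x n m := by
  unfold clebsch
  rcases lt_trichotomy m n with h | rfl | h
  · simp only [h.le, if_true, not_le.2 h, if_false, and_comm (a := 0 ≤ m)]
  · rfl
  · simp only [h.le, if_true, not_le.2 h, if_false, and_comm (a := 0 ≤ m)]

theorem clebsch_of_neg_root {x : ℤ} (h : x < 0) (m n : ℤ) : clebsch q x m n = 0 :=
  if_neg (by omega)

theorem clebsch_of_neg_left {m : ℤ} (h : m < 0) (x n : ℤ) : clebsch q x m n = 0 :=
  if_neg (by omega)

theorem clebsch_of_neg_right {n : ℤ} (h : n < 0) (x m : ℤ) : clebsch q x m n = 0 :=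
  if_neg (by omega)

theorem wallBar_eq (hq0 : 0 < q) (hq1 : q < 1) (x m p : ℕ) :
    wallBar (q ^ 2) ((q ^ 2) ^ p) m x =
      (-1) ^ x * (Real.sqrt (qPochInf (q ^ 2) (q ^ 2)) * sqrtFac q m * sqrtFac q (m + p : ℕ) /
        sqrtFac q x) * q ^ ((x : ℤ) * (m + (m + p : ℕ) + 1) - m * (m + p : ℕ)) *
        cgSum q (m + 1) x m (m + p : ℕ) := by
  have hp := qFac_pos hq0 hq1 p
  have hm := qFac_pos hq0 hq1 m
  have hx := qFac_pos hq0 hq1 x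
  have hpm := qFac_pos hq0 hq1 (p + m : ℕ)
  have e0 : ∀ j : ℕ, qPoch (q ^ 2) (q ^ 2) j = qFac q j := fun j => by simp [qFac]
  -- The power of `q` is a square, and the two shifted products together contribute
  -- `(q²;q²)_p^{-2}`; both leave the square root.
  have hs : Real.sqrt ((((q ^ 2) ^ p) * q ^ 2) ^ ((x : ℤ) - m) *
      qPochInf ((q ^ 2) ^ p * q ^ 2) (q ^ 2) * qPoch ((q ^ 2) ^ p * q ^ 2) (q ^ 2) m /
      (qPoch (q ^ 2) (q ^ 2) m * qPoch (q ^ 2) (q ^ 2) x)) =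
      q ^ (((p : ℤ) + 1) * (x - m)) * Real.sqrt (qPochInf (q ^ 2) (q ^ 2)) *
        sqrtFac q (m + p : ℕ) / (qFac q p * sqrtFac q m * sqrtFac q x) := by
    rw [← pow_succ, qPochInf_shift hq0 hq1, qPoch_shift hq0 hq1, e0, e0]
    have h1 : ((q ^ 2) ^ (p + 1)) ^ ((x : ℤ) - m) = (q ^ (((p : ℤ) + 1) * (x - m))) ^ 2 := by
      rw [← zpow_natCast, ← zpow_natCast, ← zpow_natCast, ← zpow_mul, ← zpow_mul, ← zpow_mul]
      congr 1; push_cast; ring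
    rw [h1]
    have h2 : 0 < q ^ (((p : ℤ) + 1) * (x - m)) := zpow_pos hq0 _
    have hi : 0 < qPochInf (q ^ 2) (q ^ 2) :=
      qPochInf_pos (by positivity) (pow_lt_one₀ hq0.le hq1 (by norm_num)) (by positivity)
        (pow_lt_one₀ hq0.le hq1 (by norm_num))
    have s1 := sqrtFac_pos hq0 hq1 m
    have s2 := sqrtFac_pos hq0 hq1 x
    have s3 := sqrtFac_pos hq0 hq1 (m + p : ℕ)
    rw [Real.sqrt_eq_iff_mul_self_eq (by positivity) (by positivity),
      ← sqrtFac_mul_self hq0 hq1 m, ← sqrtFac_mul_self hq0 hq1 x, add_comm p m,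
      ← sqrtFac_mul_self hq0 hq1 (m + p : ℕ)]
    have := Real.mul_self_sqrt hi.le
    field_simp
    rw [← pow_two] at this
    exact this.symm
  have hw : wall (q ^ 2) ((q ^ 2) ^ p) m ((q ^ 2) ^ x) =
      (-1) ^ m * (qFac q p * qFac q m) * q ^ ((x : ℤ) * (2 * m) - m * m + m) *
        cgSum q (m + 1) x m (m + p : ℕ) := by
    -- Reversing the terminating series makes its denominators symmetric in `m` and `m + p`.
    rw [wall, cgSum, ← sum_range_reflect, mul_sum]
    refine sum_congr rfl fun j hj => ?_
    rw [mem_range] at hj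
    obtain ⟨k, rfl⟩ : ∃ k, m = j + k := ⟨m - j, by omega⟩
    rw [show j + k + 1 - 1 - j = k by omega, qPoch_inv hq0 hq1 _ _ (by omega), ← pow_succ,
      qPoch_shift hq0 hq1, e0, cgWeight, invFac_of_nonneg (by omega), invFac_of_nonneg (by omega),
      invFac_of_nonneg (by push_cast; omega), show ((j + k : ℕ) : ℤ) - k = j by push_cast; ring,
      show ((j + k : ℕ) : ℤ) - j = k by push_cast; ring,
      show ((j + k + p : ℕ) : ℤ) - j = (p + k : ℕ) by push_cast; ring]
    have e1 : (q ^ 2 * (q ^ 2) ^ x) ^ k = q ^ (2 * ((x : ℤ) + 1) * k) := by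
      rw [← pow_succ', ← pow_mul, ← pow_mul, ← zpow_natCast]; congr 1; push_cast; ring
    have e2 : q ^ ((k : ℤ) * (k - 1) - 2 * (j + k : ℕ) * k) * q ^ (2 * ((x : ℤ) + 1) * k) =
        q ^ ((x : ℤ) * (2 * (j + k : ℕ)) - (j + k : ℕ) * (j + k : ℕ) + (j + k : ℕ)) *
        q ^ ((j : ℤ) * j - j - 2 * x * j) := by
      rw [← zpow_add₀ hq0.ne', ← zpow_add₀ hq0.ne']; congr 1; push_cast; ring
    have e3 : (-1 : ℝ) ^ (j + k) * (-1) ^ j = (-1) ^ k := by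
      rw [← pow_add, show j + k + j = 2 * j + k by ring, pow_add, pow_mul]; simp
    have h1 := qFac_pos hq0 hq1 j
    have h2 := qFac_pos hq0 hq1 k
    have h3 := qFac_pos hq0 hq1 (p + k : ℕ)
    rw [e1, ← e3]
    calc _ = (q ^ ((k : ℤ) * (k - 1) - 2 * (j + k : ℕ) * k) * q ^ (2 * ((x : ℤ) + 1) * k)) *
          ((-1) ^ (j + k) * (-1) ^ j) * (qFac q p * qFac q (j + k : ℕ)) /
          (qFac q j * qFac q k * qFac q (p + k : ℕ)) := by field_simp
      _ = _ := by rw [e2]; field_simp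
  have e3 : (-1 : ℝ) ^ (m + x) * (-1) ^ m = (-1) ^ x := by
    rw [← pow_add, show m + x + m = 2 * m + x by ring, pow_add, pow_mul]; simp
  have e4 : (q : ℝ) ^ ((x : ℤ) * (m + (m + p : ℕ) + 1) - m * (m + p : ℕ)) =
      q ^ (((p : ℤ) + 1) * (x - m)) * q ^ ((x : ℤ) * (2 * m) - m * m + m) := by
    rw [← zpow_add₀ hq0.ne']; congr 1; push_cast; ring
  have s1 := sqrtFac_pos hq0 hq1 m
  have s2 := sqrtFac_pos hq0 hq1 x
  rw [wallBar, hs, hw, e4, ← e3, ← sqrtFac_mul_self hq0 hq1 m]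
  field_simp

/-- The symmetric formula for the Clebsch-Gordan coefficients. -/
theorem clebsch_eq (hq0 : 0 < q) (hq1 : q < 1) {x : ℤ} (hx : 0 ≤ x) (m n : ℤ) {N : ℕ}
    (hN : m < N) :
    clebsch q x m n = (-1) ^ x.toNat * (Real.sqrt (qPochInf (q ^ 2) (q ^ 2)) * sqrtFac q m *
      sqrtFac q n / sqrtFac q x) * q ^ (x * (m + n + 1) - m * n) * cgSum q N x m n := by
  -- All terms with `j > m` vanish, so any cutoff beyond `m` gives the same sum.
  have hstep : ∀ {m n : ℤ} {N : ℕ}, m < N → cgSum q N x m n = cgSum q (m + 1).toNat x m n := by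
    intro m n N hN
    induction N, (show (m + 1).toNat ≤ N by omega) using Nat.le_induction with
    | base => rfl
    | succ k hk ih => rw [cgSum_succ (by omega), ih (by omega)]
  have key : ∀ {m n : ℤ} {N : ℕ}, m < N → m ≤ n → clebsch q x m n =
      (-1) ^ x.toNat * (Real.sqrt (qPochInf (q ^ 2) (q ^ 2)) * sqrtFac q m *
      sqrtFac q n / sqrtFac q x) * q ^ (x * (m + n + 1) - m * n) * cgSum q N x m n := by
    intro m n N hN hmn
    by_cases hm : m < 0
    · rw [clebsch_of_neg_left hm, cgSum_of_neg_left hm, mul_zero]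
    obtain ⟨p, rfl⟩ := Int.le.dest hmn
    lift m to ℕ using by omega
    lift x to ℕ using hx
    rw [clebsch, if_pos (by omega), if_pos hmn, hstep hN, Int.toNat_natCast, Int.toNat_natCast]
    have e : (q : ℝ) ^ (2 * ((m : ℤ) + p - m)) = (q ^ 2) ^ p := by
      rw [add_sub_cancel_left, ← pow_mul, ← zpow_natCast]; congr 1
    rw [e, wallBar_eq hq0 hq1]
    push_cast
    rfl
  rcases le_total m n with h | h
  · exact key hN h
  · have h1 : n < N := by omega
    rw [clebsch_comm, key h1 h, cgSum_comm]
    ring_nf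

/-! ### Contiguous relations -/

/-- This realizes multiplication by `q^x` as an operator that raises `n - m` by one; its mirror
image `clebsch_contiguous'` lowers `n - m`. At the edge of the range the coefficient `root q 0`
removes the term that does not fit. -/
theorem clebsch_contiguous (hq0 : 0 < q) (hq1 : q < 1) (x m n : ℤ) :
    q ^ x * clebsch q x m n =
      q ^ m * root q (n + 1) * clebsch q x m (n + 1) +
        q ^ n * root q m * clebsch q x (m - 1) n := by
  by_cases hx : x < 0
  · simp [clebsch_of_neg_root hx]
  by_cases hm : m < 0
  · rw [clebsch_of_neg_left hm, clebsch_of_neg_left hm, clebsch_of_neg_left (by omega)]; simp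
  by_cases hn : n < 0
  · rw [clebsch_of_neg_right hn, clebsch_of_neg_right hn]
    rcases (show n + 1 < 0 ∨ n + 1 = 0 by omega) with h | h
    · rw [clebsch_of_neg_right h]; simp
    · rw [h, root_zero]; simp
  push Not at hx hm hn
  obtain ⟨N, hN⟩ : ∃ N : ℕ, m < N := ⟨(m + 1).toNat, by omega⟩
  have h := cgSum_contiguous_right hq0 hq1 N x m n
  have hm' : root q m * clebsch q x (m - 1) n = (-1) ^ x.toNat *
      (Real.sqrt (qPochInf (q ^ 2) (q ^ 2)) * sqrtFac q m *
      sqrtFac q n / sqrtFac q x) * q ^ (x * (m + n) - (m - 1) * n) * cgSum q N x (m - 1) n := by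
    rcases hm.eq_or_lt with rfl | h0
    · rw [root_zero, cgSum_of_neg_left (by omega)]; simp
    · have := sqrtFac_add_one hq0 hq1 (n := m - 1) (by omega)
      rw [sub_add_cancel] at this
      rw [clebsch_eq hq0 hq1 hx (m - 1) n (N := N) (by omega), this]
      rw [show m - 1 + n + 1 = m + n by ring]
      ring
  have hn' : root q (n + 1) * clebsch q x m (n + 1) = (-1) ^ x.toNat *
      (Real.sqrt (qPochInf (q ^ 2) (q ^ 2)) * sqrtFac q m * sqrtFac q n / sqrtFac q x) *
      q ^ (x * (m + n + 2) - m * (n + 1)) *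
        ((1 - q ^ (2 * (n + 1))) * cgSum q (N + 1) x m (n + 1)) := by
    have := root_mul_sqrtFac hq0 hq1 hn
    rw [clebsch_eq hq0 hq1 hx m (n + 1) (N := N + 1) (by push_cast; omega)]
    rw [show m + (n + 1) + 1 = m + n + 2 by ring]
    linear_combination ((-1) ^ x.toNat *
      (Real.sqrt (qPochInf (q ^ 2) (q ^ 2)) * sqrtFac q m / sqrtFac q x) *
      q ^ (x * (m + n + 2) - m * (n + 1)) * cgSum q (N + 1) x m (n + 1)) * this
  rw [mul_assoc, mul_assoc, hm', hn', clebsch_eq hq0 hq1 hx m n (N := N + 1) (by push_cast; omega)]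
  have e1 : (q : ℝ) ^ x * q ^ (x * (m + n + 1) - m * n) = q ^ (x * (m + n + 2) - m * n) := by
    rw [← zpow_add₀ hq0.ne']; congr 1; ring
  have e2 : (q : ℝ) ^ m * q ^ (x * (m + n + 2) - m * (n + 1)) = q ^ (x * (m + n + 2) - m * n) := by
    rw [← zpow_add₀ hq0.ne']; congr 1; ring
  have e3 : (q : ℝ) ^ n * q ^ (x * (m + n) - (m - 1) * n) =
      q ^ (x * (m + n + 2) - m * n) * q ^ (2 * n - 2 * x) := by
    rw [← zpow_add₀ hq0.ne', ← zpow_add₀ hq0.ne']; congr 1; ring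
  set K := (-1 : ℝ) ^ x.toNat * (Real.sqrt (qPochInf (q ^ 2) (q ^ 2)) * sqrtFac q m *
      sqrtFac q n / sqrtFac q x)
  linear_combination K * cgSum q (N + 1) x m n * e1 -
    K * ((1 - q ^ (2 * (n + 1))) * cgSum q (N + 1) x m (n + 1)) * e2 -
    K * cgSum q N x (m - 1) n * e3 + K * q ^ (x * (m + n + 2) - m * n) * h

theorem clebsch_contiguous' (hq0 : 0 < q) (hq1 : q < 1) (x m n : ℤ) :
    q ^ x * clebsch q x m n =
      q ^ m * root q n * clebsch q x m (n - 1) +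
        q ^ n * root q (m + 1) * clebsch q x (m + 1) n := by
  rw [clebsch_comm, clebsch_contiguous hq0 hq1, clebsch_comm x (n - 1), clebsch_comm x n (m + 1)]
  ring

theorem clebsch_raise (hq0 : 0 < q) (hq1 : q < 1) (x m n : ℤ) :
    root q (x + 1) * clebsch q (x + 1) m n =
      root q m * root q n * clebsch q x (m - 1) (n - 1) -
        q ^ (m + n + 1) * clebsch q x m n := by
  by_cases hm : m < 0
  · rw [clebsch_of_neg_left hm, clebsch_of_neg_left hm, clebsch_of_neg_left (by omega)]; simp
  by_cases hn : n < 0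
  · rw [clebsch_of_neg_right hn, clebsch_of_neg_right hn, clebsch_of_neg_right (by omega)]; simp
  by_cases hx : x < 0
  · rw [clebsch_of_neg_root hx, clebsch_of_neg_root hx]
    rcases (show x + 1 < 0 ∨ x + 1 = 0 by omega) with h | h
    · rw [clebsch_of_neg_root h]; simp
    · rw [h, root_zero]; simp
  push Not at hx hm hn
  obtain ⟨N, hN⟩ : ∃ N : ℕ, m < N := ⟨(m + 1).toNat, by omega⟩
  have h := cgSum_raise hq0 hq1 N x m n
  set κ := Real.sqrt (qPochInf (q ^ 2) (q ^ 2))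
  have sx := sqrtFac_pos hq0 hq1 x
  have hx' : root q (x + 1) * clebsch q (x + 1) m n = -((-1) ^ x.toNat *
      (κ * sqrtFac q m * sqrtFac q n / sqrtFac q x) *
        q ^ ((x + 1) * (m + n + 1) - m * n) * cgSum q (N + 1) (x + 1) m n) := by
    have sr := root_pos hq0 hq1 (n := x + 1) (by omega)
    rw [clebsch_eq hq0 hq1 (by omega : 0 ≤ x + 1) m n (N := N + 1) (by push_cast; omega),
      sqrtFac_add_one hq0 hq1 hx, show (x + 1).toNat = x.toNat + 1 by omega, pow_succ]
    field_simp
    simp only [κ]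
    ring
  have hmn : root q m * root q n * clebsch q x (m - 1) (n - 1) = (-1) ^ x.toNat *
      (κ * sqrtFac q m * sqrtFac q n / sqrtFac q x) *
        q ^ (x * (m + n - 1) - (m - 1) * (n - 1)) * cgSum q N x (m - 1) (n - 1) := by
    rcases hm.eq_or_lt with rfl | h0
    · rw [root_zero, cgSum_of_neg_left (by omega)]; simp
    rcases hn.eq_or_lt with rfl | h1
    · rw [root_zero, cgSum_comm, cgSum_of_neg_left (by omega)]; simp
    have s1 := sqrtFac_add_one hq0 hq1 (n := m - 1) (by omega)
    have s2 := sqrtFac_add_one hq0 hq1 (n := n - 1) (by omega)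
    rw [sub_add_cancel] at s1 s2
    rw [clebsch_eq hq0 hq1 hx (m - 1) (n - 1) (N := N) (by omega), s1, s2,
      show m - 1 + (n - 1) + 1 = m + n - 1 by ring]
    ring
  rw [hx', hmn, clebsch_eq hq0 hq1 hx m n (N := N + 1) (by push_cast; omega)]
  have e1 : (q : ℝ) ^ ((x + 1) * (m + n + 1) - m * n) =
      q ^ (m + n + 1) * q ^ (x * (m + n + 1) - m * n) := by
    rw [← zpow_add₀ hq0.ne']; congr 1; ring
  have e2 : (q : ℝ) ^ (x * (m + n - 1) - (m - 1) * (n - 1)) =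
      q ^ (m + n + 1) * q ^ (x * (m + n + 1) - m * n) * q ^ (-2 * x - 2) := by
    rw [← zpow_add₀ hq0.ne', ← zpow_add₀ hq0.ne']; congr 1; ring
  rw [e1, e2]
  linear_combination ((-1) ^ x.toNat * (κ * sqrtFac q m * sqrtFac q n / sqrtFac q x) *
    q ^ (m + n + 1) * q ^ (x * (m + n + 1) - m * n)) * h

theorem clebsch_lower (hq0 : 0 < q) (hq1 : q < 1) (x m n : ℤ) :
    root q x * clebsch q (x - 1) m n =
      root q (m + 1) * root q (n + 1) * clebsch q x (m + 1) (n + 1) -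
        q ^ (m + n + 1) * clebsch q x m n := by
  by_cases hx : x < 0
  · rw [clebsch_of_neg_root hx, clebsch_of_neg_root hx, clebsch_of_neg_root (by omega)]; simp
  by_cases hm : m < 0
  · rw [clebsch_of_neg_left hm, clebsch_of_neg_left hm]
    rcases (show m + 1 < 0 ∨ m + 1 = 0 by omega) with h | h
    · rw [clebsch_of_neg_left h]; simp
    · rw [h, root_zero]; simp
  by_cases hn : n < 0
  · rw [clebsch_of_neg_right hn, clebsch_of_neg_right hn]
    rcases (show n + 1 < 0 ∨ n + 1 = 0 by omega) with h | h
    · rw [clebsch_of_neg_right h]; simp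
    · rw [h, root_zero]; simp
  push Not at hx hm hn
  obtain ⟨N, hN⟩ : ∃ N : ℕ, m < N := ⟨(m + 1).toNat, by omega⟩
  have h := cgSum_lower hq0 hq1 N x m n hN
  set κ := Real.sqrt (qPochInf (q ^ 2) (q ^ 2))
  have sx := sqrtFac_pos hq0 hq1 x
  have hx' : root q x * clebsch q (x - 1) m n = -((-1) ^ x.toNat *
      (κ * sqrtFac q m * sqrtFac q n / sqrtFac q x) *
        q ^ ((x - 1) * (m + n + 1) - m * n) * ((1 - q ^ (2 * x)) * cgSum q N (x - 1) m n)) := by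
    rcases hx.eq_or_lt with rfl | h0
    · rw [root_zero]; simp
    have s1 := root_mul_sqrtFac hq0 hq1 (n := x - 1) (by omega)
    have sr := sqrtFac_pos hq0 hq1 (x - 1)
    rw [sub_add_cancel] at s1
    rw [clebsch_eq hq0 hq1 (by omega : 0 ≤ x - 1) m n (N := N) hN]
    obtain ⟨k, hk⟩ : ∃ k, x.toNat = k + 1 := ⟨x.toNat - 1, by omega⟩
    rw [show (x - 1).toNat = k by omega, hk, pow_succ]
    field_simp
    simp only [κ]
    linear_combination (-1) ^ k * √(qPochInf (q ^ 2) (q ^ 2)) * sqrtFac q m * sqrtFac q n *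
      cgSum q N (x - 1) m n * s1
  have hmn : root q (m + 1) * root q (n + 1) * clebsch q x (m + 1) (n + 1) = (-1) ^ x.toNat *
      (κ * sqrtFac q m * sqrtFac q n / sqrtFac q x) *
        q ^ (x * (m + n + 3) - (m + 1) * (n + 1)) *
        ((1 - q ^ (2 * (m + 1))) * (1 - q ^ (2 * (n + 1))) *
          cgSum q (N + 1) x (m + 1) (n + 1)) := by
    have s1 := root_mul_sqrtFac hq0 hq1 hm
    have s2 := root_mul_sqrtFac hq0 hq1 hn
    rw [clebsch_eq hq0 hq1 hx (m + 1) (n + 1) (N := N + 1) (by push_cast; omega),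
      show m + 1 + (n + 1) + 1 = m + n + 3 by ring]
    calc _ = (-1) ^ x.toNat * (κ * (root q (m + 1) * sqrtFac q (m + 1)) *
          (root q (n + 1) * sqrtFac q (n + 1)) / sqrtFac q x) *
          q ^ (x * (m + n + 3) - (m + 1) * (n + 1)) * cgSum q (N + 1) x (m + 1) (n + 1) := by ring
      _ = _ := by rw [s1, s2]; ring
  rw [hx', hmn, clebsch_eq hq0 hq1 hx m n hN]
  have e1 : (q : ℝ) ^ (x * (m + n + 3) - (m + 1) * (n + 1)) =
      q ^ ((x - 1) * (m + n + 1) - m * n) * q ^ (2 * x) := by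
    rw [← zpow_add₀ hq0.ne']; congr 1; ring
  have e2 : (q : ℝ) ^ (m + n + 1) * q ^ (x * (m + n + 1) - m * n) =
      q ^ ((x - 1) * (m + n + 1) - m * n) * q ^ (2 * (m + n + 1)) := by
    rw [← zpow_add₀ hq0.ne', ← zpow_add₀ hq0.ne']; congr 1; ring
  set K := (-1 : ℝ) ^ x.toNat * (κ * sqrtFac q m * sqrtFac q n / sqrtFac q x)
  rw [e1]
  linear_combination (-(K * q ^ ((x - 1) * (m + n + 1) - m * n))) * h +
    K * cgSum q N x m n * e2

end QSU2

namespace QSU2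

/-! ### Orthonormal systems of square summable functions -/

theorem memℓp_two_iff {κ : Type*} {f : κ → ℝ} : Memℓp f 2 ↔ Summable fun k => f k ^ 2 := by
  rw [memℓp_gen_iff (by simp)]
  simp

/-- Tonelli: for nonnegative terms the iterated sum already yields summability of the double sum. -/
theorem hasSum_prod_of_nonneg {α β : Type*} {f : α × β → ℝ} (hf : 0 ≤ f) {g : α → ℝ}
    (h : ∀ a, HasSum (fun b => f (a, b)) (g a)) {s : ℝ} (hg : HasSum g s) : HasSum f s := by
  have hs : Summable f := by
    rw [summable_prod_of_nonneg hf]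
    refine ⟨fun a => (h a).summable, ?_⟩
    simpa only [(h _).tsum_eq] using hg.summable
  have := hs.hasSum.prod_fiberwise h
  rw [hg.unique this]
  exact hs.hasSum

theorem summable_mul_of_sq {κ : Type*} {f g : κ → ℝ} (hf : Summable fun k => f k ^ 2)
    (hg : Summable fun k => g k ^ 2) : Summable fun k => f k * g k := by
  refine Summable.of_norm_bounded (hf.add hg) fun k => ?_
  rw [Real.norm_eq_abs, abs_le]
  constructor <;> nlinarith [sq_nonneg (f k + g k), sq_nonneg (f k - g k), sq_nonneg (f k),
    sq_nonneg (g k)]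

theorem summable_mul_mul_of_sq {κ : Type*} {b f g : κ → ℝ} (hf : Summable fun k => f k ^ 2)
    (hg : Summable fun k => g k ^ 2) (hb : ∀ k, |b k * f k| ≤ |f k|) :
    Summable fun k => b k * f k * g k := by
  refine Summable.of_norm_bounded (summable_mul_of_sq hf hg).norm fun k => ?_
  rw [norm_mul (b k * f k), norm_mul (f k)]
  exact mul_le_mul_of_nonneg_right (hb k) (norm_nonneg (g k))

theorem hasSum_inner_lp {κ : Type*} (f g : lp (fun _ : κ => ℝ) 2) :
    HasSum (fun k => f k * g k) (inner ℝ f g) := by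
  simpa [mul_comm] using lp.hasSum_inner (𝕜 := ℝ) f g

theorem orthonormal_lp {ι κ : Type*} [DecidableEq ι] (g : ι → lp (fun _ : κ => ℝ) 2)
    (hg : ∀ i j, HasSum (fun k => g i k * g j k) (if i = j then 1 else 0)) :
    Orthonormal ℝ g := by
  rw [orthonormal_iff_ite]
  exact fun i j => (hasSum_inner_lp _ _).unique (hg i j)

/-- A square summable combination of an orthonormal system of functions. -/
theorem exists_hasSum_smul {ι κ : Type*} [DecidableEq ι] (g : ι → lp (fun _ : κ => ℝ) 2)
    (hg : ∀ i j, HasSum (fun k => g i k * g j k) (if i = j then 1 else 0)) (h : ι → ℝ)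
    (hh : Summable fun i => h i ^ 2) :
    ∃ v : lp (fun _ : κ => ℝ) 2, HasSum (fun i => h i • g i) v ∧ ‖v‖ ^ 2 = ∑' i, h i ^ 2 ∧
      ∀ j, inner ℝ (g j) v = h j := by
  have ho := orthonormal_lp g hg
  let H : lp (fun _ : ι => ℝ) 2 := ⟨h, memℓp_two_iff.2 hh⟩
  have hs : HasSum (fun i => h i • g i) (ho.orthogonalFamily.linearIsometry H) :=
    ho.orthogonalFamily.hasSum_linearIsometry H
  refine ⟨_, hs, ?_, fun j => ?_⟩
  · rw [LinearIsometry.norm_map, ← real_inner_self_eq_norm_sq, lp.inner_eq_tsum]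
    refine tsum_congr fun i => ?_
    rw [pow_two]
    rfl
  · have h1 := hs.mapL (innerSL ℝ (g j))
    have h2 : HasSum (fun i => innerSL ℝ (g j) (h i • g i)) (h j) := by
      convert hasSum_ite_eq j (h j) using 2 with i
      rw [innerSL_apply_apply, inner_smul_right, orthonormal_iff_ite.1 ho]
      by_cases hij : j = i
      · subst hij; simp
      · rw [if_neg hij, if_neg (Ne.symm hij), mul_zero]
    exact h1.unique h2

theorem summable_sq_of_hasSum {ι κ : Type*} [DecidableEq ι] {g : ι → κ → ℝ}
    (hg : ∀ i j, HasSum (fun k => g i k * g j k) (if i = j then 1 else 0)) (i : ι) :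
    Summable fun k => g i k ^ 2 := by
  simpa only [pow_two] using (hg i i).summable

/-- Square summable combinations of an orthonormal system, in coordinates. -/
theorem orthonormal_expansion {ι κ : Type*} [DecidableEq ι] {g : ι → κ → ℝ}
    (hg : ∀ i j, HasSum (fun k => g i k * g j k) (if i = j then 1 else 0)) {h : ι → ℝ}
    (hh : Summable fun i => h i ^ 2) :
    HasSum (fun k => (∑' i, h i * g i k) ^ 2) (∑' i, h i ^ 2) ∧
      ∀ j, HasSum (fun k => g j k * ∑' i, h i * g i k) (h j) := by
  let G : ι → lp (fun _ : κ => ℝ) 2 := fun i => ⟨g i, memℓp_two_iff.2 (summable_sq_of_hasSum hg i)⟩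
  obtain ⟨v, hv, hn, hj⟩ := exists_hasSum_smul G hg h hh
  have hc : ∀ k, ∑' i, h i * g i k = v k := fun k =>
    (hv.mapL (lp.evalCLM ℝ (fun _ : κ => ℝ) 2 k)).tsum_eq
  simp only [hc]
  refine ⟨?_, fun j => ?_⟩
  · rw [← hn, ← real_inner_self_eq_norm_sq]
    simpa only [pow_two] using hasSum_inner_lp v v
  · rw [← hj j]
    exact hasSum_inner_lp (G j) v

/-- Bessel's inequality for the coordinate functionals. -/
theorem summable_sq_coord {ι κ : Type*} [DecidableEq ι] {g : ι → κ → ℝ}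
    (hg : ∀ i j, HasSum (fun k => g i k * g j k) (if i = j then 1 else 0)) (k : κ) :
    Summable fun i => g i k ^ 2 := by
  classical
  let G : ι → lp (fun _ : κ => ℝ) 2 := fun i => ⟨g i, memℓp_two_iff.2 (summable_sq_of_hasSum hg i)⟩
  have := (orthonormal_lp G hg).inner_products_summable (lp.single 2 k (1 : ℝ))
  refine this.congr fun i => ?_
  rw [lp.inner_single_right]
  simp [G]

/-- A vector whose norm is exhausted by its coefficients is the sum of its expansion. -/
theorem hasSum_of_parseval {ι κ : Type*} [DecidableEq ι] (g : ι → lp (fun _ : κ => ℝ) 2)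
    (hg : ∀ i j, HasSum (fun k => g i k * g j k) (if i = j then 1 else 0))
    (v : lp (fun _ : κ => ℝ) 2) {c : ι → ℝ} (hc : ∀ i, HasSum (fun k => v k * g i k) (c i))
    (hs : HasSum (fun i => c i ^ 2) (‖v‖ ^ 2)) : HasSum (fun i => c i • g i) v := by
  obtain ⟨u, hu, hn, hj⟩ := exists_hasSum_smul g hg c hs.summable
  have h1 : inner ℝ v u = ‖v‖ ^ 2 := by
    have h2 := hu.mapL (innerSL ℝ v)
    refine h2.unique (hs.congr_fun fun i => ?_)
    rw [innerSL_apply_apply, inner_smul_right, (hasSum_inner_lp v (g i)).unique (hc i), pow_two]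
  -- Expanding the square gives `‖v‖² - 2‖v‖² + ‖v‖²`; totality of the system in the whole space
  -- plays no role.
  have h0 : ‖v - u‖ ^ 2 = 0 := by
    rw [norm_sub_sq_real, h1, hn, hs.tsum_eq]; ring
  have : v = u := by
    rw [← sub_eq_zero, ← norm_eq_zero]
    exact pow_eq_zero_iff (by norm_num) |>.1 h0
  rwa [this]

end QSU2

namespace QSU2

open Finset Filter Topology

variable {q : ℝ}

/-! ### Orthogonality with respect to the root label -/

theorem tendsto_qFac (hq0 : 0 < q) (hq1 : q < 1) :
    Tendsto (fun n : ℕ => qFac q n) atTop (𝓝 (qPochInf (q ^ 2) (q ^ 2))) := by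
  have := (multipliable_qPochInf (q := q ^ 2) (by positivity)
    (pow_lt_one₀ hq0.le hq1 (by norm_num)) (q ^ 2)).hasProd.tendsto_prod_nat
  simpa [qFac, qPoch, qPochInf] using this

theorem qPochInf_sq_pos (hq0 : 0 < q) (hq1 : q < 1) : 0 < qPochInf (q ^ 2) (q ^ 2) :=
  qPochInf_pos (by positivity) (pow_lt_one₀ hq0.le hq1 (by norm_num)) (by positivity)
    (pow_lt_one₀ hq0.le hq1 (by norm_num))

theorem qPochInf_le_qFac (hq0 : 0 < q) (hq1 : q < 1) (n : ℕ) :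
    qPochInf (q ^ 2) (q ^ 2) ≤ qFac q n := by
  refine Antitone.le_of_tendsto (antitone_nat_of_succ_le fun n => ?_) (tendsto_qFac hq0 hq1) n
  have h := qFac_add_one (q := q) (n := n) (by omega)
  have h1 := qFac_pos hq0 hq1 n
  have h2 := zpow_pos hq0 (2 * ((n : ℤ) + 1))
  push_cast
  rw [h]
  nlinarith

/-- The series `∑_x q^{2x(n+1)} / (q²;q²)_x` at `z = q^{2(n+1)}` of the `q`-binomial theorem. -/
theorem hasSum_qBinomial (hq0 : 0 < q) (hq1 : q < 1) (n : ℕ) :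
    HasSum (fun x : ℕ => (q ^ (2 * (n + 1))) ^ x / qFac q x)
      (qFac q n / qPochInf (q ^ 2) (q ^ 2)) := by
  set κ := qPochInf (q ^ 2) (q ^ 2) with hκ
  have hκ0 : 0 < κ := qPochInf_sq_pos hq0 hq1
  have hz : ∀ n : ℕ, q ^ (2 * (n + 1)) ≤ q ^ 2 := fun n =>
    pow_le_pow_of_le_one hq0.le hq1.le (by omega)
  have hb : ∀ n x : ℕ, ‖(q ^ (2 * (n + 1))) ^ x / qFac q x‖ ≤ (q ^ 2) ^ x / κ := by
    intro n x
    have := qFac_pos hq0 hq1 x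
    rw [Real.norm_of_nonneg (by positivity)]
    have h1 := hz n
    have h2 := qPochInf_le_qFac hq0 hq1 x
    gcongr
  have hbs : Summable fun x : ℕ => (q ^ 2) ^ x / κ :=
    (summable_geometric_of_lt_one (by positivity) (pow_lt_one₀ hq0.le hq1 (by norm_num))).div_const _
  have hs : ∀ n : ℕ, Summable fun x : ℕ => (q ^ (2 * (n + 1))) ^ x / qFac q x := fun n =>
    Summable.of_norm_bounded hbs (hb n)
  set S : ℕ → ℝ := fun n => ∑' x : ℕ, (q ^ (2 * (n + 1))) ^ x / qFac q x with hS
  -- The functional equation of the series: in `S n - S (n+1)` the factor `1 - q^{2x}` cancels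
  -- against `(q²;q²)_x`.
  have hrec : ∀ n, S (n + 1) = (1 - q ^ (2 * (n + 1))) * S n := by
    intro n
    have h1 : S n - S (n + 1) = q ^ (2 * (n + 1)) * S n := by
      rw [hS]
      simp only
      rw [← (hs n).tsum_sub (hs (n + 1)), ((hs n).sub (hs (n + 1))).tsum_eq_zero_add, ← tsum_mul_left]
      simp only [pow_zero, sub_self, zero_add]
      refine tsum_congr fun y => ?_
      have h := qFac_add_one (q := q) (n := y) (by omega)
      have hp := one_sub_zpow_pos hq0 hq1 (n := (y : ℤ) + 1) (by omega)
      have e : (q : ℝ) ^ (2 * ((y : ℤ) + 1)) = q ^ (2 * (y + 1)) := by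
        rw [← zpow_natCast]; congr 1
      have hf := qFac_pos hq0 hq1 y
      rw [e] at h hp
      push_cast
      rw [h, ← sub_div, div_eq_iff (by positivity)]
      field_simp
      ring
    linarith
  have hlim : Tendsto S atTop (𝓝 1) := by
    have h0 : ∑' x : ℕ, (if x = 0 then (1 : ℝ) else 0) = 1 := tsum_ite_eq _ _
    rw [← h0]
    refine tendsto_tsum_of_dominated_convergence hbs (fun x => ?_)
      (Eventually.of_forall fun n x => hb n x)
    rcases Nat.eq_zero_or_pos x with rfl | hx
    · simp [qFac_zero]
    · rw [if_neg hx.ne']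
      have h1 : Tendsto (fun n : ℕ => q ^ (2 * (n + 1))) atTop (𝓝 0) :=
        (tendsto_pow_atTop_nhds_zero_of_lt_one hq0.le hq1).comp
          (tendsto_atTop_mono (fun n => by simp only [id]; omega) tendsto_id)
      have h2 := (h1.pow x).div_const (qFac q x)
      rwa [zero_pow hx.ne', zero_div] at h2
  -- The quotient obeys a trivial recursion, so it equals its limit as `n → ∞`, where only the term
  -- `x = 0` of the series survives.
  have hconst : ∀ n, S n / qFac q n = S 0 / qFac q 0 := by
    intro n
    induction n with
    | zero => rfl
    | succ n ih =>
      have h := qFac_add_one (q := q) (n := n) (by omega)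
      have hp := one_sub_zpow_pos hq0 hq1 (n := (n : ℤ) + 1) (by omega)
      have e : (q : ℝ) ^ (2 * ((n : ℤ) + 1)) = q ^ (2 * (n + 1)) := by
        rw [← zpow_natCast]; congr 1
      rw [e] at h hp
      have hf := qFac_pos hq0 hq1 n
      rw [← ih, hrec]
      push_cast
      rw [h]
      field_simp
  have hl : Tendsto (fun n : ℕ => S n / qFac q n) atTop (𝓝 (1 / κ)) :=
    hlim.div (tendsto_qFac hq0 hq1) hκ0.ne'
  have hn : S n / qFac q n = 1 / κ := by
    have h1 : Tendsto (fun m : ℕ => S m / qFac q m) atTop (𝓝 (S n / qFac q n)) := by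
      simp only [hconst]
      exact tendsto_const_nhds
    exact tendsto_nhds_unique h1 hl
  have hf := qFac_pos hq0 hq1 n
  have : S n = qFac q n / κ := by
    rw [div_eq_iff hf.ne'] at hn
    rw [hn]; ring
  rw [← this]
  exact (hs n).hasSum

theorem clebsch_zero_left (hq0 : 0 < q) (hq1 : q < 1) {x n : ℤ} (hx : 0 ≤ x) (hn : 0 ≤ n) :
    clebsch q x 0 n = (-1) ^ x.toNat * (Real.sqrt (qPochInf (q ^ 2) (q ^ 2)) /
      (sqrtFac q n * sqrtFac q x)) * q ^ (x * (n + 1)) := by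
  have h1 := sqrtFac_pos hq0 hq1 n
  have h2 := sqrtFac_pos hq0 hq1 x
  rw [clebsch_eq hq0 hq1 hx 0 n (N := 1) (by norm_num), cgSum, sum_range_one, cgWeight,
    Nat.cast_zero, sub_zero n, sub_zero (0 : ℤ), invFac_of_nonneg le_rfl, invFac_of_nonneg hn,
    ← sqrtFac_mul_self hq0 hq1 n, sqrtFac, qFac_zero]
  simp only [pow_zero, mul_zero, sub_self, zpow_zero, Real.sqrt_one, zero_add, zero_mul, sub_zero,
    inv_one, mul_one, one_mul]
  field_simp

theorem clebsch_zero_left_ne_zero (hq0 : 0 < q) (hq1 : q < 1) {x n : ℤ} (hx : 0 ≤ x)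
    (hn : 0 ≤ n) : clebsch q x 0 n ≠ 0 := by
  have h1 := sqrtFac_pos hq0 hq1 n
  have h2 := sqrtFac_pos hq0 hq1 x
  have h3 := Real.sqrt_pos.2 (qPochInf_sq_pos hq0 hq1)
  have h4 := zpow_pos hq0 (x * (n + 1))
  rw [clebsch_zero_left hq0 hq1 hx hn]
  have : ((-1 : ℝ) ^ x.toNat) ≠ 0 := pow_ne_zero _ (by norm_num)
  positivity

/-- Sums over `ℤ` of functions that vanish at negative integers. -/
theorem hasSum_int_of_nat {f : ℤ → ℝ} (hf : ∀ x < 0, f x = 0) {a : ℝ}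
    (h : HasSum (fun x : ℕ => f x) a) : HasSum f a := by
  refine (Nat.cast_injective.hasSum_iff fun x hx => hf x ?_).1 h
  by_contra h0
  exact hx ⟨x.toNat, by simp; omega⟩

theorem hasSum_clebsch_zero_sq (hq0 : 0 < q) (hq1 : q < 1) {n : ℤ} (hn : 0 ≤ n) :
    HasSum (fun x : ℤ => clebsch q x 0 n * clebsch q x 0 n) 1 := by
  refine hasSum_int_of_nat (fun x hx => by rw [clebsch_of_neg_root hx, zero_mul]) ?_
  lift n to ℕ using hn
  have h := (hasSum_qBinomial hq0 hq1 n).mul_left (qPochInf (q ^ 2) (q ^ 2) / qFac q n)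
  have h1 := qFac_pos hq0 hq1 n
  have h2 := qPochInf_sq_pos hq0 hq1
  rw [div_mul_div_cancel₀ h1.ne', div_self h2.ne'] at h
  refine h.congr_fun fun x => ?_
  have h3 := qFac_pos hq0 hq1 x
  have s1 := sqrtFac_pos hq0 hq1 n
  have s2 := sqrtFac_pos hq0 hq1 x
  have e : (q ^ (2 * (n + 1))) ^ x = q ^ ((x : ℤ) * (n + 1)) * q ^ ((x : ℤ) * (n + 1)) := by
    rw [← zpow_add₀ hq0.ne', ← pow_mul, ← zpow_natCast]; congr 1; push_cast; ring
  have e2 : ((-1 : ℝ) ^ x) * (-1) ^ x = 1 := by rw [← mul_pow]; simp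
  have h4 := Real.mul_self_sqrt h2.le
  rw [clebsch_zero_left hq0 hq1 (by omega) (by omega), e, Int.toNat_natCast,
    ← sqrtFac_mul_self hq0 hq1 n, ← sqrtFac_mul_self hq0 hq1 x]
  calc _ = ((-1) ^ x * (-1) ^ x) * (√(qPochInf (q ^ 2) (q ^ 2)) * √(qPochInf (q ^ 2) (q ^ 2))) /
        (sqrtFac q n * sqrtFac q n * (sqrtFac q x * sqrtFac q x)) *
        (q ^ ((x : ℤ) * (n + 1)) * q ^ ((x : ℤ) * (n + 1))) := by field_simp
    _ = _ := by rw [e2, h4]; field_simp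

theorem abs_zpow_mul_clebsch_le (hq0 : 0 < q) (hq1 : q < 1) (x m n : ℤ) :
    |q ^ x * clebsch q x m n| ≤ |clebsch q x m n| := by
  by_cases hx : x < 0
  · simp [clebsch_of_neg_root hx]
  rw [abs_mul, abs_of_pos (zpow_pos hq0 x)]
  exact mul_le_of_le_one_left (abs_nonneg _) (zpow_le_one₀ hq0 hq1.le (by omega))

/-- For `m ≤ n`, induction on `m`: the contiguous relation expresses `C_{x,m+1,n}` through `q^x
C_{x,m,n}` and `C_{x,m,n-1}`, and `q^x ≤ 1` wherever the coefficient is nonzero. Symmetry gives the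
other case. -/
theorem summable_sq_clebsch_root (hq0 : 0 < q) (hq1 : q < 1) (m n : ℤ) :
    Summable fun x : ℤ => clebsch q x m n ^ 2 := by
  by_cases hm : m < 0
  · simp [clebsch_of_neg_left hm]
  by_cases hn : n < 0
  · simp [clebsch_of_neg_right hn]
  have key : ∀ (m : ℕ) (n : ℤ), (m : ℤ) ≤ n → Summable fun x : ℤ => clebsch q x m n ^ 2 := by
    intro m
    induction m with
    | zero =>
      intro n hn
      simpa [pow_two] using (hasSum_clebsch_zero_sq hq0 hq1 hn).summable
    | succ m ih =>
      intro n hn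
      push_cast at hn ⊢
      have h1 := (ih n (by omega)).of_norm_bounded_eventually (g := fun x => clebsch q x m n ^ 2)
        (f := fun x => (q ^ x * clebsch q x m n) ^ 2) (Eventually.of_forall fun x => by
          rw [Real.norm_of_nonneg (sq_nonneg _)]
          exact sq_le_sq.2 (abs_zpow_mul_clebsch_le hq0 hq1 x m n))
      have h2 := ih (n - 1) (by omega)
      have h3 := ((memℓp_two_iff.2 h1).sub ((memℓp_two_iff.2 h2).const_mul
        (q ^ (m : ℤ) * root q n))).const_mul (q ^ n * root q (m + 1))⁻¹
      refine (memℓp_two_iff.1 h3).congr fun x => ?_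
      have hr := root_pos hq0 hq1 (n := (m : ℤ) + 1) (by omega)
      have hz := zpow_pos hq0 n
      congr 1
      simp only [Pi.sub_apply, clebsch_contiguous' hq0 hq1 x m n]
      field_simp
      ring
  rcases le_total m n with h | h
  · lift m to ℕ using by omega
    exact key m n h
  · lift n to ℕ using by omega
    simpa only [clebsch_comm _ m] using key n m h

theorem summable_clebsch_root (hq0 : 0 < q) (hq1 : q < 1) (m n m' n' : ℤ) :
    Summable fun x : ℤ => clebsch q x m n * clebsch q x m' n' :=
  summable_mul_of_sq (summable_sq_clebsch_root hq0 hq1 m n) (summable_sq_clebsch_root hq0 hq1 m' n')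

/-- Both sides come from evaluating `∑ q^x C_{x,m,n} C_{x,m',n'}` twice, with the factor `q^x`
absorbed by the first or by the second coefficient. -/
theorem tsum_clebsch_root_rec (hq0 : 0 < q) (hq1 : q < 1) (m n m' n' : ℤ) :
    q ^ n * root q (m + 1) * ∑' x : ℤ, clebsch q x (m + 1) n * clebsch q x m' n' =
      q ^ m' * root q (n' + 1) * ∑' x : ℤ, clebsch q x m n * clebsch q x m' (n' + 1) +
      q ^ n' * root q m' * ∑' x : ℤ, clebsch q x m n * clebsch q x (m' - 1) n' -
      q ^ m * root q n * ∑' x : ℤ, clebsch q x m (n - 1) * clebsch q x m' n' := by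
  have hs := summable_clebsch_root hq0 hq1
  rw [← tsum_mul_left, ← tsum_mul_left, ← tsum_mul_left, ← tsum_mul_left,
    ← ((hs m n m' (n' + 1)).mul_left _).tsum_add ((hs m n (m' - 1) n').mul_left _),
    ← (((hs m n m' (n' + 1)).mul_left _).add ((hs m n (m' - 1) n').mul_left _)).tsum_sub
      ((hs m (n - 1) m' n').mul_left _)]
  refine tsum_congr fun x => ?_
  linear_combination clebsch q x m n * clebsch_contiguous hq0 hq1 x m' n' -
    clebsch q x m' n' * clebsch_contiguous' hq0 hq1 x m n

theorem tsum_clebsch_root (hq0 : 0 < q) (hq1 : q < 1) (p m m' : ℕ) :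
    ∑' x : ℤ, clebsch q x m (m + p) * clebsch q x m' (m' + p) = if m = m' then 1 else 0 := by
  have hr : ∀ k n : ℕ, 0 < q ^ (n : ℤ) * root q (k + 1) := fun k n =>
    mul_pos (zpow_pos hq0 _) (root_pos hq0 hq1 (by omega))
  -- When the second lower label is `0`, the recursion loses its term with `m' - 1`. The recursion
  -- from `m` to `m + 1` uses the differences `p` and `p + 1`, so `p` must stay general.
  have h0 : ∀ m' p : ℕ, ∑' x : ℤ, clebsch q x m' (m' + p) * clebsch q x (0 : ℕ) ((0 : ℕ) + p) =
      if m' = 0 then 1 else 0 := by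
    intro m'
    induction m' with
    | zero => intro p; simpa using (hasSum_clebsch_zero_sq hq0 hq1 (n := p) (by omega)).tsum_eq
    | succ k ih =>
      intro p
      have h := tsum_clebsch_root_rec hq0 hq1 k (k + 1 + p : ℕ) 0 p
      have h1 := ih (p + 1)
      have h2 := ih p
      push_cast at h h1 h2 ⊢
      simp only [zero_add] at h1 h2 h ⊢
      rw [show (k : ℤ) + (p + 1) = k + 1 + p by ring] at h1
      rw [show (k : ℤ) + 1 + p - 1 = k + p by ring, h1, h2, root_zero] at h
      have h3 := hr k (k + 1 + p)
      push_cast at h3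
      refine (mul_eq_zero_iff_left h3.ne').1 (h.trans ?_)
      by_cases hk : k = 0
      · subst hk
        simp [add_comm]
      · simp [hk]
  induction m generalizing p m' with
  | zero =>
    rw [← tsum_congr fun x : ℤ => mul_comm _ _]
    simpa [eq_comm] using h0 m' p
  | succ k ih =>
    have h := tsum_clebsch_root_rec hq0 hq1 k (k + 1 + p : ℕ) m' (m' + p : ℕ)
    have h1 := ih (p + 1) m'
    have h2 := ih p m'
    have h3 : q ^ ((m' + p : ℕ) : ℤ) * root q m' * ∑' x : ℤ, clebsch q x k (k + 1 + p : ℕ) *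
        clebsch q x (m' - 1) (m' + p : ℕ) =
        if k + 1 = m' then q ^ ((m' + p : ℕ) : ℤ) * root q m' else 0 := by
      cases m' with
      | zero => simp [root_zero]
      | succ l =>
        have h4 := ih (p + 1) l
        push_cast at h4 ⊢
        simp only [add_sub_cancel_right]
        rw [show (k : ℤ) + 1 + p = k + (p + 1) by ring, show (l : ℤ) + 1 + p = l + (p + 1) by ring,
          h4]
        by_cases hk : k = l <;> simp [hk]
    rw [h3] at h
    push_cast at h h1 h2 ⊢
    rw [show (k : ℤ) + (p + 1) = k + 1 + p by ring,
      show (m' : ℤ) + (p + 1) = m' + p + 1 by ring] at h1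
    rw [show (k : ℤ) + 1 + p - 1 = k + p by ring, h1, h2] at h
    have h5 := hr k (k + 1 + p)
    push_cast at h5
    refine mul_left_cancel₀ h5.ne' (h.trans ?_)
    by_cases hk : k = m'
    · subst hk
      have hk : ¬ (k + 1 = k) := by omega
      simp only [if_true, hk, if_false]
      rw [show (k : ℤ) + p + 1 = k + 1 + p by ring]
      ring
    · by_cases hk' : k + 1 = m'
      · subst hk'
        simp
      · simp [hk, hk']

theorem hasSum_clebsch_root (hq0 : 0 < q) (hq1 : q < 1) {m n m' n' : ℤ} (hm : 0 ≤ m)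
    (hn : 0 ≤ n) (hm' : 0 ≤ m') (hn' : 0 ≤ n') (h : n - m = n' - m') :
    HasSum (fun x : ℤ => clebsch q x m n * clebsch q x m' n') (if m = m' then 1 else 0) := by
  rw [(summable_clebsch_root hq0 hq1 m n m' n').hasSum_iff]
  rcases le_total m n with h0 | h0
  · obtain ⟨p, rfl⟩ := Int.le.dest h0
    obtain rfl : n' = m' + p := by omega
    lift m to ℕ using hm
    lift m' to ℕ using hm'
    simpa using tsum_clebsch_root hq0 hq1 p m m'
  · obtain ⟨p, rfl⟩ := Int.le.dest h0
    obtain rfl : m' = n' + p := by omega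
    lift n to ℕ using hn
    lift n' to ℕ using hn'
    simp only [clebsch_comm _ (_ + (p : ℤ))]
    simpa using tsum_clebsch_root hq0 hq1 p n n'

theorem abs_clebsch_le_one (hq0 : 0 < q) (hq1 : q < 1) (x m n : ℤ) : |clebsch q x m n| ≤ 1 := by
  by_cases hm : m < 0
  · simp [clebsch_of_neg_left hm]
  by_cases hn : n < 0
  · simp [clebsch_of_neg_right hn]
  have h := hasSum_clebsch_root hq0 hq1 (m := m) (n := n) (m' := m) (n' := n) (by omega) (by omega)
    (by omega) (by omega) rfl
  rw [if_pos rfl] at h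
  rw [← sq_le_one_iff_abs_le_one, pow_two]
  exact le_hasSum h x fun y _ => mul_self_nonneg _

/-! ### Orthogonality with respect to the leaf labels -/

/-- The integers `m` for which both `m` and `m + p` are natural numbers. -/
def leafIndex (p : ℤ) : Set ℤ := {m | 0 ≤ m ∧ 0 ≤ m + p}

theorem mem_leafIndex {p m : ℤ} : m ∈ leafIndex p ↔ 0 ≤ m ∧ 0 ≤ m + p := Iff.rfl

/-- Indices outside `leafIndex p` belong to the zero function, so they must be left out of the
orthonormal system. -/
theorem hasSum_clebsch_index (hq0 : 0 < q) (hq1 : q < 1) (p : ℤ)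
    (m m' : leafIndex p) :
    HasSum (fun x : ℤ => clebsch q x m (m + p) * clebsch q x m' (m' + p))
      (if m = m' then 1 else 0) := by
  have hm := mem_leafIndex.1 m.2
  have hm' := mem_leafIndex.1 m'.2
  have := hasSum_clebsch_root hq0 hq1 hm.1 hm.2 hm'.1 hm'.2 (by ring)
  simpa only [← Subtype.ext_iff] using this

theorem support_subset_index {f : ℤ → ℝ} {p : ℤ} (hf : ∀ m, (m < 0 ∨ m + p < 0) → f m = 0) :
    Function.support f ⊆ leafIndex p := by
  intro m hm
  by_contra h0
  refine hm (hf m ?_)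
  rw [mem_leafIndex] at h0
  omega

theorem clebsch_index_eq_zero {m p : ℤ} (x : ℤ) (h : m < 0 ∨ m + p < 0) :
    clebsch q x m (m + p) = 0 := by
  rcases h with h | h
  · exact clebsch_of_neg_left h _ _
  · exact clebsch_of_neg_right h _ _

/-- Bessel's inequality for the coordinate functional at `x`, applied to the system orthonormal in
`x`. -/
theorem summable_sq_clebsch_leaf (hq0 : 0 < q) (hq1 : q < 1) (x p : ℤ) :
    Summable fun m : ℤ => clebsch q x m (m + p) ^ 2 := by
  have h := summable_sq_coord (hasSum_clebsch_index hq0 hq1 p) x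
  exact ((hasSum_subtype_iff_of_support_subset (f := fun m : ℤ => clebsch q x m (m + p) ^ 2)
    (support_subset_index fun m hm => by rw [clebsch_index_eq_zero x hm]; norm_num)).1
    h.hasSum).summable

/-- Justifies splitting and shifting the sums over leaves below; `b` needs a bound only where the
first coefficient can be nonzero. -/
theorem summable_clebsch_leaf (hq0 : 0 < q) (hq1 : q < 1) {b : ℤ → ℝ} (x x' p p' e : ℤ)
    (hb : ∀ m, 0 ≤ m → 0 ≤ m + p → |b m| ≤ 1) :
    Summable fun m : ℤ => b m * clebsch q x m (m + p) * clebsch q x' (m + e) (m + p') := by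
  have h1 := summable_sq_clebsch_leaf hq0 hq1 x p
  have h2 := (Equiv.addRight e).summable_iff.2 (summable_sq_clebsch_leaf hq0 hq1 x' (p' - e))
  refine summable_mul_mul_of_sq h1 (h2.congr fun m => ?_) fun m => ?_
  · simp only [Function.comp_apply, Equiv.coe_addRight]
    rw [show m + e + (p' - e) = m + p' by ring]
  · by_cases hm : m < 0 ∨ m + p < 0
    · simp [clebsch_index_eq_zero x hm]
    · rw [abs_mul]
      exact mul_le_of_le_one_left (abs_nonneg _) (hb m (by omega) (by omega))

theorem abs_zpow_mul_root_le_one (hq0 : 0 < q) (hq1 : q < 1) {m : ℤ} (hm : 0 ≤ m) (n : ℤ) :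
    |q ^ m * root q n| ≤ 1 := by
  rw [abs_mul, abs_of_pos (zpow_pos hq0 m), abs_of_nonneg (root_nonneg n)]
  exact mul_le_one₀ (zpow_le_one₀ hq0 hq1.le hm) (root_nonneg n) (root_le_one hq0 n)

/-- The two contiguous relations are adjoint to each other: after `q^x` has been absorbed by the
first coefficient and one term shifted by `m ↦ m + 1`, the second coefficient recombines to give
`q^{x'}`. -/
theorem tsum_clebsch_leaf_shift (hq0 : 0 < q) (hq1 : q < 1) (x x' p : ℤ) :
    q ^ x * ∑' m : ℤ, clebsch q x m (m + p) * clebsch q x' m (m + p) =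
      q ^ x' * ∑' m : ℤ, clebsch q x m (m + (p + 1)) * clebsch q x' m (m + (p + 1)) := by
  have h1 : Summable fun m : ℤ => q ^ m * root q (m + (p + 1)) * clebsch q x m (m + (p + 1)) *
      clebsch q x' m (m + p) := by
    simpa using summable_clebsch_leaf hq0 hq1 x x' (p + 1) p 0
      (b := fun m => q ^ m * root q (m + (p + 1)))
      fun m hm _ => abs_zpow_mul_root_le_one hq0 hq1 hm _
  have h2 : Summable fun m : ℤ => q ^ (m + (p + 1)) * root q (m + 1) *
      clebsch q x m (m + (p + 1)) * clebsch q x' (m + 1) (m + (p + 1)) := by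
    simpa using summable_clebsch_leaf hq0 hq1 x x' (p + 1) (p + 1) 1
      (b := fun m => q ^ (m + (p + 1)) * root q (m + 1))
      fun m _ hm => abs_zpow_mul_root_le_one hq0 hq1 hm _
  have h2' : Summable fun m : ℤ => q ^ (m + p) * root q m *
      clebsch q x (m - 1) (m + p) * clebsch q x' m (m + p) := by
    refine ((Equiv.subRight 1).summable_iff.2 h2).congr fun m => ?_
    simp only [Function.comp_apply, Equiv.subRight_apply]
    rw [show m - 1 + (p + 1) = m + p by ring, sub_add_cancel]
  rw [← tsum_mul_left, ← tsum_mul_left]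
  calc _ = ∑' m : ℤ, (q ^ m * root q (m + (p + 1)) * clebsch q x m (m + (p + 1)) *
      clebsch q x' m (m + p) + q ^ (m + p) * root q m *
      clebsch q x (m - 1) (m + p) * clebsch q x' m (m + p)) := by
        refine tsum_congr fun m => ?_
        have := clebsch_contiguous hq0 hq1 x m (m + p)
        rw [show m + p + 1 = m + (p + 1) by ring] at this
        linear_combination clebsch q x' m (m + p) * this
    _ = ∑' m : ℤ, (q ^ m * root q (m + (p + 1)) * clebsch q x m (m + (p + 1)) *
      clebsch q x' m (m + p) + q ^ (m + (p + 1)) * root q (m + 1) *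
      clebsch q x m (m + (p + 1)) * clebsch q x' (m + 1) (m + (p + 1))) := by
        rw [h1.tsum_add h2', h1.tsum_add h2]
        congr 1
        rw [← (Equiv.addRight (1 : ℤ)).tsum_eq]
        refine tsum_congr fun m => ?_
        simp only [Equiv.coe_addRight]
        rw [show m + 1 + p = m + (p + 1) by ring, add_sub_cancel_right]
    _ = _ := by
        refine tsum_congr fun m => ?_
        have := clebsch_contiguous' hq0 hq1 x' m (m + (p + 1))
        rw [show m + (p + 1) - 1 = m + p by ring] at this
        linear_combination -clebsch q x m (m + (p + 1)) * this

/-- Using the shift identity for `(x, x')` and for `(x', x)` gives `(q^{2x} - q^{2x'}) D = 0` for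
the inner product `D`. The diagonal value cannot be found this way and comes from the orthonormality
in `x`. -/
theorem hasSum_clebsch_leaf (hq0 : 0 < q) (hq1 : q < 1) {x x' : ℤ} (hx : 0 ≤ x) (hx' : 0 ≤ x')
    (p : ℤ) : HasSum (fun m : ℤ => clebsch q x m (m + p) * clebsch q x' m (m + p))
      (if x = x' then 1 else 0) := by
  have hs : ∀ x x' : ℤ, Summable fun m : ℤ => clebsch q x m (m + p) * clebsch q x' m (m + p) :=
    fun x x' => summable_mul_of_sq (summable_sq_clebsch_leaf hq0 hq1 x p)
      (summable_sq_clebsch_leaf hq0 hq1 x' p)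
  have h0 : ∀ x' : ℤ, x ≠ x' →
      ∑' m : ℤ, clebsch q x m (m + p) * clebsch q x' m (m + p) = 0 := by
    intro x' hne
    by_cases hx' : x' < 0
    · simp [clebsch_of_neg_root hx']
    have h1 := tsum_clebsch_leaf_shift hq0 hq1 x x' p
    have h2 := tsum_clebsch_leaf_shift hq0 hq1 x' x p
    rw [tsum_congr fun m : ℤ => mul_comm (clebsch q x' m (m + p)) _,
      tsum_congr fun m : ℤ => mul_comm (clebsch q x' m (m + (p + 1))) _] at h2
    set D := ∑' m : ℤ, clebsch q x m (m + p) * clebsch q x' m (m + p)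
    set E := ∑' m : ℤ, clebsch q x m (m + (p + 1)) * clebsch q x' m (m + (p + 1))
    have h3 : (q ^ (2 * x) - q ^ (2 * x')) * D = 0 := by
      rw [show 2 * x = x + x by ring, show 2 * x' = x' + x' by ring, zpow_add₀ hq0.ne',
        zpow_add₀ hq0.ne']
      linear_combination q ^ x * h1 - q ^ x' * h2
    rcases mul_eq_zero.1 h3 with h | h
    · exfalso
      have := zpow_right_injective₀ hq0 hq1.ne (sub_eq_zero.1 h)
      omega
    · exact h
  have hD : ∑' m : ℤ, clebsch q x m (m + p) * clebsch q x m (m + p) = 1 := by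
    have hg := hasSum_clebsch_index hq0 hq1 p
    -- The combination with coefficients `C_{x,i,i+p}` has the inner product `D` of the rows `x` and
    -- `x'` as its coordinate at `x'`. Only `x' = x` survives, so pairing with a system member `j`
    -- reads `C_{x,j,j+p} D = C_{x,j,j+p}`.
    have h1 := (orthonormal_expansion hg (summable_sq_coord hg x)).2
    have h2 : ∀ x' : ℤ, ∑' i : leafIndex p,
        clebsch q x i (i + p) * clebsch q x' i (i + p) =
        ∑' m : ℤ, clebsch q x m (m + p) * clebsch q x' m (m + p) := by
      intro x'
      refine tsum_subtype_eq_of_support_subset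
        (f := fun m => clebsch q x m (m + p) * clebsch q x' m (m + p))
        (support_subset_index fun m hm => ?_)
      rw [clebsch_index_eq_zero x hm, zero_mul]
    simp only [h2] at h1
    obtain ⟨j, hj⟩ : ∃ j : leafIndex p, clebsch q x j (j + p) ≠ 0 := by
      rcases le_total 0 p with hp | hp
      · refine ⟨⟨0, mem_leafIndex.2 (by omega)⟩, ?_⟩
        simpa using clebsch_zero_left_ne_zero hq0 hq1 hx hp
      · refine ⟨⟨-p, mem_leafIndex.2 (by omega)⟩, ?_⟩
        rw [clebsch_comm]
        simpa using clebsch_zero_left_ne_zero hq0 hq1 hx (n := -p) (by omega)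
    have h3 := (h1 j).unique (hasSum_single x fun x' hne => by rw [h0 x' hne.symm, mul_zero])
    exact (mul_right_eq_self₀.1 h3.symm).resolve_right hj
  rw [(hs x x').hasSum_iff]
  by_cases h : x = x'
  · subst h; rw [if_pos rfl, hD]
  · rw [if_neg h, h0 x' h]

end QSU2

namespace QSU2

variable {q : ℝ}

/-! ### Coupling sums -/

/-- `∑_n C_{x,n,n+p} C_{n+p,n+d,c} C_{a,n,n+d}`, the inner product of a threefold vector coupled
from the right with `e^{12}_{a,d} ⊗ e_c`. -/
noncomputable def coupling (q : ℝ) (x p a c d : ℤ) : ℝ :=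
  ∑' n : ℤ, clebsch q x n (n + p) * clebsch q (n + p) (n + d) c * clebsch q a n (n + d)

/-- Lowering both roots `N` and `a` produces diagonal terms that cancel, since `q^n q^{m+c+1} = q^c
q^{n+m+1}`; the remaining products are reorganized by contiguous relations in which `m` is the
shared label. -/
theorem clebsch_exchange_lower (hq0 : 0 < q) (hq1 : q < 1) (N m n a c : ℤ) :
    q ^ n * root q N * clebsch q (N - 1) m c * clebsch q a n m +
        q ^ N * root q (n + 1) * clebsch q N (m + 1) c * clebsch q a (n + 1) (m + 1) =
      q ^ a * root q (c + 1) * (clebsch q N (m + 1) (c + 1) * clebsch q a n (m + 1)) +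
        q ^ c * root q a * (clebsch q N m c * clebsch q (a - 1) n m) := by
  have e1 := clebsch_lower hq0 hq1 N m c
  have e2 := clebsch_lower hq0 hq1 a n m
  have e3 := clebsch_contiguous' hq0 hq1 a n (m + 1)
  have e4 := clebsch_contiguous hq0 hq1 N (m + 1) c
  have e5 : (q : ℝ) ^ n * q ^ (m + c + 1) = q ^ c * q ^ (n + m + 1) := by
    rw [← zpow_add₀ hq0.ne', ← zpow_add₀ hq0.ne']; congr 1; ring
  rw [add_sub_cancel_right] at e3 e4
  linear_combination q ^ n * clebsch q a n m * e1 - q ^ c * clebsch q N m c * e2 -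
    root q (c + 1) * clebsch q N (m + 1) (c + 1) * e3 +
    root q (n + 1) * clebsch q a (n + 1) (m + 1) * e4 -
    clebsch q N m c * clebsch q a n m * e5

theorem clebsch_exchange_raise (hq0 : 0 < q) (hq1 : q < 1) (N m n a c : ℤ) :
    q ^ n * root q (N + 1) * clebsch q (N + 1) m c * clebsch q a n m +
        q ^ N * root q n * clebsch q N (m - 1) c * clebsch q a (n - 1) (m - 1) =
      q ^ a * root q c * (clebsch q N (m - 1) (c - 1) * clebsch q a n (m - 1)) +
        q ^ c * root q (a + 1) * (clebsch q N m c * clebsch q (a + 1) n m) := by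
  have e1 := clebsch_raise hq0 hq1 N m c
  have e2 := clebsch_raise hq0 hq1 a n m
  have e3 := clebsch_contiguous hq0 hq1 a n (m - 1)
  have e4 := clebsch_contiguous' hq0 hq1 N (m - 1) c
  have e5 : (q : ℝ) ^ n * q ^ (m + c + 1) = q ^ c * q ^ (n + m + 1) := by
    rw [← zpow_add₀ hq0.ne', ← zpow_add₀ hq0.ne']; congr 1; ring
  rw [sub_add_cancel] at e3 e4
  linear_combination q ^ n * clebsch q a n m * e1 - q ^ c * clebsch q N m c * e2 -
    root q c * clebsch q N (m - 1) (c - 1) * e3 +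
    root q n * clebsch q a (n - 1) (m - 1) * e4 -
    clebsch q N m c * clebsch q a n m * e5

theorem abs_mul_clebsch_le_one (hq0 : 0 < q) (hq1 : q < 1) {b : ℝ} (hb : |b| ≤ 1) (x m n : ℤ) :
    |b * clebsch q x m n| ≤ 1 := by
  rw [abs_mul]
  exact mul_le_one₀ hb (abs_nonneg _) (abs_clebsch_le_one hq0 hq1 x m n)

theorem summable_coupling (hq0 : 0 < q) (hq1 : q < 1) (x p a c d : ℤ) :
    Summable fun n : ℤ =>
      clebsch q x n (n + p) * clebsch q (n + p) (n + d) c * clebsch q a n (n + d) := by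
  refine (summable_clebsch_leaf hq0 hq1 (b := fun n => clebsch q (n + p) (n + d) c) x a p d 0
    fun n _ _ => abs_clebsch_le_one hq0 hq1 _ _ _).congr fun n => ?_
  rw [add_zero]
  ring

theorem coupling_of_neg_left {a : ℤ} (h : a < 0) (x p c d : ℤ) : coupling q x p a c d = 0 := by
  simp [coupling, clebsch_of_neg_root h]

theorem coupling_of_neg_right {c : ℤ} (h : c < 0) (x p a d : ℤ) : coupling q x p a c d = 0 := by
  simp [coupling, clebsch_of_neg_right h]

/-- The factor `q^x` is absorbed by `C_{x,n,n+p}`. A shift of `n` in one of the two terms makes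
`C_{x,n,n+p+1}` a common factor, and the exchange identity rewrites the other two coefficients. -/
theorem coupling_lower (hq0 : 0 < q) (hq1 : q < 1) (x p a c d : ℤ) :
    q ^ x * coupling q x p a c d =
      q ^ a * root q (c + 1) * coupling q x (p + 1) a (c + 1) (d + 1) +
        q ^ c * root q a * coupling q x (p + 1) (a - 1) c d := by
  have hs := summable_coupling hq0 hq1
  obtain ⟨X, X_def⟩ : ∃ X : ℤ → ℝ, ∀ n, X n = q ^ n * root q (n + (p + 1)) *
    clebsch q (n + p) (n + d) c * clebsch q x n (n + (p + 1)) * clebsch q a n (n + d) :=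
    ⟨_, fun _ => rfl⟩
  obtain ⟨Z, Z_def⟩ : ∃ Z : ℤ → ℝ, ∀ n, Z n = q ^ (n + (p + 1)) * root q (n + 1) *
    clebsch q (n + (p + 1)) (n + (d + 1)) c *
    clebsch q x n (n + (p + 1)) * clebsch q a (n + 1) (n + (d + 1)) := ⟨_, fun _ => rfl⟩
  have hX : Summable X := by
    refine (summable_clebsch_leaf hq0 hq1 x a (p + 1) d 0
      (b := fun n => q ^ n * root q (n + (p + 1)) * clebsch q (n + p) (n + d) c) fun n hn _ =>
        abs_mul_clebsch_le_one hq0 hq1 (abs_zpow_mul_root_le_one hq0 hq1 hn _) _ _ _).congr fun n => ?_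
    rw [X_def, add_zero]
  have hZ : Summable Z := by
    refine (summable_clebsch_leaf hq0 hq1 x a (p + 1) (d + 1) 1
      (b := fun n => q ^ (n + (p + 1)) * root q (n + 1) *
        clebsch q (n + (p + 1)) (n + (d + 1)) c) fun n _ hn =>
        abs_mul_clebsch_le_one hq0 hq1 (abs_zpow_mul_root_le_one hq0 hq1 hn _) _ _ _).congr fun n => ?_
    rw [Z_def]
  have hZ' : Summable fun n => Z (n - 1) :=
    (Equiv.subRight (1 : ℤ)).summable_iff (f := Z) |>.2 hZ
  have hshift : ∑' n, Z (n - 1) = ∑' n, Z n := (Equiv.subRight (1 : ℤ)).tsum_eq Z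
  rw [coupling, coupling, coupling, ← tsum_mul_left, ← tsum_mul_left, ← tsum_mul_left,
    ← ((hs _ _ _ _ _).mul_left _).tsum_add ((hs _ _ _ _ _).mul_left _)]
  calc _ = ∑' n : ℤ, (X n + Z (n - 1)) := by
        refine tsum_congr fun n => ?_
        have := clebsch_contiguous hq0 hq1 x n (n + p)
        simp only [X_def, Z_def]
        rw [show n + p + 1 = n + (p + 1) by ring] at this
        rw [show n - 1 + (p + 1) = n + p by ring, show n - 1 + (d + 1) = n + d by ring,
          sub_add_cancel]
        linear_combination clebsch q (n + p) (n + d) c * clebsch q a n (n + d) * this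
    _ = ∑' n : ℤ, (X n + Z n) := by rw [hX.tsum_add hZ', hX.tsum_add hZ, hshift]
    _ = _ := by
        refine tsum_congr fun n => ?_
        have := clebsch_exchange_lower hq0 hq1 (n + (p + 1)) (n + d) n a c
        simp only [X_def, Z_def]
        rw [show n + (p + 1) - 1 = n + p by ring, show n + d + 1 = n + (d + 1) by ring] at this
        linear_combination clebsch q x n (n + (p + 1)) * this

theorem coupling_raise (hq0 : 0 < q) (hq1 : q < 1) (x p a c d : ℤ) :
    q ^ x * coupling q x (p + 1) a c d =
      q ^ a * root q c * coupling q x p a (c - 1) (d - 1) +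
        q ^ c * root q (a + 1) * coupling q x p (a + 1) c d := by
  have hs := summable_coupling hq0 hq1
  obtain ⟨X, X_def⟩ : ∃ X : ℤ → ℝ, ∀ n, X n = q ^ n * root q (n + (p + 1)) *
    clebsch q (n + (p + 1)) (n + d) c * clebsch q x n (n + p) * clebsch q a n (n + d) :=
    ⟨_, fun _ => rfl⟩
  obtain ⟨Z, Z_def⟩ : ∃ Z : ℤ → ℝ, ∀ n, Z n = q ^ (n + p) * root q n *
    clebsch q (n + p) (n + (d - 1)) c *
    clebsch q x n (n + p) * clebsch q a (n - 1) (n + (d - 1)) := ⟨_, fun _ => rfl⟩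
  have hX : Summable X := by
    refine (summable_clebsch_leaf hq0 hq1 x a p d 0
      (b := fun n => q ^ n * root q (n + (p + 1)) * clebsch q (n + (p + 1)) (n + d) c)
      fun n hn _ => abs_mul_clebsch_le_one hq0 hq1 (abs_zpow_mul_root_le_one hq0 hq1 hn _) _ _ _).congr fun n => ?_
    rw [X_def, add_zero]
  have hZ : Summable Z := by
    refine (summable_clebsch_leaf hq0 hq1 x a p (d - 1) (-1)
      (b := fun n => q ^ (n + p) * root q n *
        clebsch q (n + p) (n + (d - 1)) c) fun n _ hn =>
        abs_mul_clebsch_le_one hq0 hq1 (abs_zpow_mul_root_le_one hq0 hq1 hn _) _ _ _).congr fun n => ?_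
    rw [Z_def, sub_eq_add_neg n]
  have hZ' : Summable fun n => Z (n + 1) :=
    (Equiv.addRight (1 : ℤ)).summable_iff (f := Z) |>.2 hZ
  have hshift : ∑' n, Z (n + 1) = ∑' n, Z n := (Equiv.addRight (1 : ℤ)).tsum_eq Z
  rw [coupling, coupling, coupling, ← tsum_mul_left, ← tsum_mul_left, ← tsum_mul_left,
    ← ((hs _ _ _ _ _).mul_left _).tsum_add ((hs _ _ _ _ _).mul_left _)]
  calc _ = ∑' n : ℤ, (X n + Z (n + 1)) := by
        refine tsum_congr fun n => ?_
        have := clebsch_contiguous' hq0 hq1 x n (n + (p + 1))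
        simp only [X_def, Z_def]
        rw [show n + (p + 1) - 1 = n + p by ring] at this
        rw [show n + 1 + p = n + (p + 1) by ring, show n + 1 + (d - 1) = n + d by ring,
          add_sub_cancel_right]
        linear_combination clebsch q (n + (p + 1)) (n + d) c * clebsch q a n (n + d) * this
    _ = ∑' n : ℤ, (X n + Z n) := by rw [hX.tsum_add hZ', hX.tsum_add hZ, hshift]
    _ = _ := by
        refine tsum_congr fun n => ?_
        have := clebsch_exchange_raise hq0 hq1 (n + p) (n + d) n a c
        simp only [X_def, Z_def]
        rw [show n + p + 1 = n + (p + 1) by ring, show n + d - 1 = n + (d - 1) by ring] at this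
        linear_combination clebsch q x n (n + p) * this

/-- Solutions of the contiguous relations are determined by their boundary values. -/
theorem eq_zero_of_contiguous (hq0 : 0 < q) (hq1 : q < 1) {x : ℤ} {H K : ℤ → ℤ → ℝ}
    (h1 : ∀ a c, q ^ x * H a c =
      q ^ a * root q (c + 1) * K a (c + 1) + q ^ c * root q a * K (a - 1) c)
    (h2 : ∀ a c, q ^ x * K a c =
      q ^ a * root q c * H a (c - 1) + q ^ c * root q (a + 1) * H (a + 1) c)
    (hz : ∀ a c, (a < 0 ∨ c < 0) → H a c = 0) {a c : ℤ} (ha : 0 ≤ a) (hc : 0 ≤ c)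
    (hac : a = 0 ∨ c = 0) (h0 : H a c = 0) (i : ℕ) : H (a + i) (c + i) = 0 := by
  have key : ∀ i : ℕ, H (a + i - 1) (c + i - 1) = 0 ∧ H (a + i) (c + i) = 0 := by
    intro i
    induction i with
    | zero =>
      -- The starting point lies on the boundary of the quadrant, so its predecessor on the diagonal
      -- lies outside.
      refine ⟨hz _ _ ?_, by simpa using h0⟩
      push_cast
      omega
    | succ i ih =>
      push_cast
      rw [show a + ((i : ℤ) + 1) - 1 = a + i by ring, show c + ((i : ℤ) + 1) - 1 = c + i by ring,
        show a + ((i : ℤ) + 1) = a + i + 1 by ring, show c + ((i : ℤ) + 1) = c + i + 1 by ring]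
      refine ⟨ih.2, ?_⟩
      -- Two consecutive zeros of `H` give a zero of `K` between them (`e3`), hence the next zero of
      -- `K` (`e1`) and the next zero of `H` (`e2`).
      have e1 := h1 (a + i) (c + i)
      have e2 := h2 (a + i) (c + i + 1)
      have e3 := h2 (a + i - 1) (c + i)
      rw [add_sub_cancel_right, ih.2] at e2
      rw [sub_add_cancel, ih.2, ih.1] at e3
      rw [ih.2] at e1
      have hx := zpow_pos hq0 x
      have hK : K (a + i - 1) (c + i) = 0 := by
        refine (mul_eq_zero_iff_left hx.ne').1 (e3.trans ?_)
        ring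
      rw [hK, mul_zero, mul_zero, add_zero] at e1
      have r1 := root_pos hq0 hq1 (n := c + i + 1) (by omega)
      have r2 := root_pos hq0 hq1 (n := a + i + 1) (by omega)
      have z1 := zpow_pos hq0 (a + i)
      have z2 := zpow_pos hq0 (c + i + 1)
      have hK' : K (a + i) (c + i + 1) = 0 :=
        (mul_eq_zero_iff_left (mul_pos z1 r1).ne').1 e1.symm
      rw [hK', mul_zero, mul_zero, zero_add] at e2
      exact (mul_eq_zero_iff_left (mul_pos z2 r2).ne').1 e2.symm
  exact (key i).2

/-- Recoupling: the coupling sums are proportional to Clebsch-Gordan coefficients. -/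
theorem exists_coupling_eq (hq0 : 0 < q) (hq1 : q < 1) {x : ℤ} (hx : 0 ≤ x) (p e δ : ℤ) :
    ∃ l : ℝ, ∀ a c : ℤ, c - a = δ → coupling q x p a c (c + e) = l * clebsch q x a c := by
  obtain ⟨a₀, c₀, ha, hc, hac, hδ, hne⟩ : ∃ a₀ c₀ : ℤ, 0 ≤ a₀ ∧ 0 ≤ c₀ ∧ (a₀ = 0 ∨ c₀ = 0) ∧
      c₀ - a₀ = δ ∧ clebsch q x a₀ c₀ ≠ 0 := by
    rcases le_total 0 δ with h | h
    · exact ⟨0, δ, le_rfl, h, Or.inl rfl, by ring, clebsch_zero_left_ne_zero hq0 hq1 hx h⟩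
    · refine ⟨-δ, 0, by omega, le_rfl, Or.inr rfl, by ring, ?_⟩
      rw [clebsch_comm]
      exact clebsch_zero_left_ne_zero hq0 hq1 hx (by omega)
  set f := coupling q x p a₀ c₀ (c₀ + e)
  set g := clebsch q x a₀ c₀
  refine ⟨f / g, fun a c hd => ?_⟩
  by_cases hneg : a < 0 ∨ c < 0
  · rcases hneg with h | h
    · rw [coupling_of_neg_left h, clebsch_of_neg_left h, mul_zero]
    · rw [coupling_of_neg_right h, clebsch_of_neg_right h, mul_zero]
  -- The difference normalized to vanish at `(a₀, c₀)`. The companion `K` has `p + 1` in the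
  -- coupling sum but the same Clebsch-Gordan term.
  have := eq_zero_of_contiguous hq0 hq1 (x := x)
    (H := fun a c => coupling q x p a c (c + e) * g - f * clebsch q x a c)
    (K := fun a c => coupling q x (p + 1) a c (c + e) * g - f * clebsch q x a c)
    (fun a c => by
      have h1 := coupling_lower hq0 hq1 x p a c (c + e)
      have h2 := clebsch_contiguous hq0 hq1 x a c
      rw [show c + e + 1 = c + 1 + e by ring] at h1
      linear_combination g * h1 - f * h2)
    (fun a c => by
      have h1 := coupling_raise hq0 hq1 x p a c (c + e)
      have h2 := clebsch_contiguous' hq0 hq1 x a c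
      rw [show c + e - 1 = c - 1 + e by ring] at h1
      linear_combination g * h1 - f * h2)
    (fun a c h => by
      rcases h with h | h
      · simp only [coupling_of_neg_left h, clebsch_of_neg_left h]; ring
      · simp only [coupling_of_neg_right h, clebsch_of_neg_right h]; ring)
    ha hc hac (by simp only [f, g]; ring) (a - a₀).toNat
  rw [show a₀ + ((a - a₀).toNat : ℤ) = a by omega,
    show c₀ + ((a - a₀).toNat : ℤ) = c by omega] at this
  field_simp
  linarith

end QSU2

namespace QSU2

variable {q : ℝ}

/-! ### Tree vectors on integer tuples -/

/-- `treeRight` as a function of integer coordinates. -/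
noncomputable def intRight (q : ℝ) :
    (k : ℕ) → ℤ → (Fin (k + 2) → ℤ) → (Fin k → ℤ) → (Fin (k + 2) → ℤ) → ℝ
  | 0, x, n, _, m => if m 1 - m 0 = n 1 - n 0 then clebsch q x (m 0) (m 1) else 0
  | k + 1, x, n, r, m =>
      clebsch q x (m 0) (r 0 + (m 0 - n 0)) *
        intRight q k (r 0 + (m 0 - n 0)) (Fin.tail n + Pi.single 0 (m 0 - n 0)) (Fin.tail r)
          (Fin.tail m)

/-- `treeLeft` as a function of integer coordinates. -/
noncomputable def intLeft (q : ℝ) :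
    (k : ℕ) → ℤ → (Fin (k + 2) → ℤ) → (Fin k → ℤ) → (Fin (k + 2) → ℤ) → ℝ
  | 0, x, n, _, m => if m 1 - m 0 = n 1 - n 0 then clebsch q x (m 0) (m 1) else 0
  | k + 1, x, n, s, m =>
      clebsch q x (s (Fin.last k) + (m (Fin.last (k + 2)) - n (Fin.last (k + 2))))
          (m (Fin.last (k + 2))) *
        intLeft q k (s (Fin.last k) + (m (Fin.last (k + 2)) - n (Fin.last (k + 2))))
          (Fin.init n + Pi.single (Fin.last (k + 1)) (m (Fin.last (k + 2)) - n (Fin.last (k + 2))))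
          (Fin.init s) (Fin.init m)

theorem intRight_natCast (k : ℕ) (x : ℤ) (n : Fin (k + 2) → ℤ) (r : Fin k → ℤ)
    (m : Fin (k + 2) → ℕ) : intRight q k x n r (fun i => (m i : ℤ)) = treeRight q k x n r m := by
  induction k generalizing x with
  | zero => rfl
  | succ k ih =>
    rw [intRight, treeRight]
    exact congrArg _ (ih _ _ _ _)

theorem intLeft_natCast (k : ℕ) (x : ℤ) (n : Fin (k + 2) → ℤ) (s : Fin k → ℤ)
    (m : Fin (k + 2) → ℕ) : intLeft q k x n s (fun i => (m i : ℤ)) = treeLeft q k x n s m := by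
  induction k generalizing x with
  | zero => rfl
  | succ k ih =>
    rw [intLeft, treeLeft]
    exact congrArg _ (ih _ _ _ _)

theorem intRight_zero_of_neg {x : ℤ} {n : Fin 2 → ℤ} {r : Fin 0 → ℤ} {m : Fin 2 → ℤ} {i : Fin 2}
    (h : m i < 0) : intRight q 0 x n r m = 0 := by
  rw [intRight]
  split_ifs
  · revert h
    refine Fin.cases (fun h => clebsch_of_neg_left h _ _) (fun j => ?_) i
    obtain rfl : j = 0 := Subsingleton.elim _ _
    exact fun h => clebsch_of_neg_right h _ _
  · rfl

theorem intRight_of_neg (k : ℕ) (x : ℤ) (n : Fin (k + 2) → ℤ) (r : Fin k → ℤ)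
    (m : Fin (k + 2) → ℤ) (i : Fin (k + 2)) (h : m i < 0) : intRight q k x n r m = 0 := by
  induction k generalizing x with
  | zero => exact intRight_zero_of_neg h
  | succ k ih =>
    rw [intRight]
    revert h
    refine Fin.cases (fun h => ?_) (fun j h => ?_) i
    · rw [clebsch_of_neg_left h, zero_mul]
    · rw [ih _ _ _ (Fin.tail m) j h, mul_zero]

theorem intLeft_of_neg (k : ℕ) (x : ℤ) (n : Fin (k + 2) → ℤ) (s : Fin k → ℤ)
    (m : Fin (k + 2) → ℤ) (i : Fin (k + 2)) (h : m i < 0) : intLeft q k x n s m = 0 := by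
  induction k generalizing x with
  | zero => exact intRight_zero_of_neg (r := s) h
  | succ k ih =>
    rw [intLeft]
    revert h
    refine Fin.lastCases (fun h => ?_) (fun j h => ?_) i
    · rw [clebsch_of_neg_right h, zero_mul]
    · rw [ih _ _ _ (Fin.init m) j h, mul_zero]

theorem intRight_of_neg_root (k : ℕ) {x : ℤ} (hx : x < 0) (n : Fin (k + 2) → ℤ) (r : Fin k → ℤ)
    (m : Fin (k + 2) → ℤ) : intRight q k x n r m = 0 := by
  cases k <;> simp [intRight, clebsch_of_neg_root hx]

theorem intLeft_of_neg_root (k : ℕ) {x : ℤ} (hx : x < 0) (n : Fin (k + 2) → ℤ) (s : Fin k → ℤ)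
    (m : Fin (k + 2) → ℤ) : intLeft q k x n s m = 0 := by
  cases k <;> simp [intLeft, clebsch_of_neg_root hx]

/-- Sums over natural tuples as sums over integer tuples. -/
theorem hasSum_natCast_iff {d : ℕ} {f : (Fin d → ℤ) → ℝ} (hf : ∀ m i, m i < 0 → f m = 0) {a : ℝ} :
    HasSum (fun m : Fin d → ℕ => f fun i => (m i : ℤ)) a ↔ HasSum f a := by
  refine Function.Injective.hasSum_iff (g := fun (m : Fin d → ℕ) (i : Fin d) => (m i : ℤ))
    (fun m m' h => ?_) fun m hm => ?_
  · funext i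
    exact Nat.cast_injective (congrFun h i)
  · by_contra h0
    refine hm ⟨fun i => (m i).toNat, ?_⟩
    funext i
    have : ¬ m i < 0 := fun h => h0 (hf m i h)
    simp only
    omega

theorem tsum_natCast {d : ℕ} {f : (Fin d → ℤ) → ℝ} (hf : ∀ m i, m i < 0 → f m = 0) :
    ∑' m : Fin d → ℕ, f (fun i => (m i : ℤ)) = ∑' m, f m := by
  by_cases h : Summable f
  · exact ((hasSum_natCast_iff hf).2 h.hasSum).tsum_eq
  · rw [tsum_eq_zero_of_not_summable h, tsum_eq_zero_of_not_summable]
    rintro ⟨a, ha⟩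
    exact h ⟨a, (hasSum_natCast_iff hf).1 ha⟩

/-! ### Orthogonality of tree vectors -/

theorem intRight_cons (k : ℕ) (x : ℤ) (n : Fin (k + 3) → ℤ) (r : Fin (k + 1) → ℤ) (l : ℤ)
    (z : Fin (k + 2) → ℤ) :
    intRight q (k + 1) x n r (Fin.cons l z) = clebsch q x l (l + (r 0 - n 0)) *
      intRight q k (l + (r 0 - n 0)) (Fin.tail n + Pi.single 0 (l - n 0)) (Fin.tail r) z := by
  rw [intRight, Fin.cons_zero, Fin.tail_cons, show r 0 + (l - n 0) = l + (r 0 - n 0) by ring]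

theorem intLeft_snoc (k : ℕ) (x : ℤ) (n : Fin (k + 3) → ℤ) (s : Fin (k + 1) → ℤ) (l : ℤ)
    (z : Fin (k + 2) → ℤ) :
    intLeft q (k + 1) x n s (Fin.snoc z l) =
      clebsch q x (l + (s (Fin.last k) - n (Fin.last (k + 2)))) l *
      intLeft q k (l + (s (Fin.last k) - n (Fin.last (k + 2))))
        (Fin.init n + Pi.single (Fin.last (k + 1)) (l - n (Fin.last (k + 2)))) (Fin.init s) z := by
  rw [intLeft, Fin.snoc_last, Fin.init_snoc, show s (Fin.last k) + (l - n (Fin.last (k + 2))) =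
    l + (s (Fin.last k) - n (Fin.last (k + 2))) by ring]

theorem hasSum_const_mul {ι : Type*} {f g : ι → ℝ} {a c b : ℝ} (hf : HasSum f a)
    (h : ∀ i, g i = c * f i) (hb : b = c * a) : HasSum g b := by
  rw [hb]
  exact (hf.mul_left c).congr_fun h

theorem hasSum_of_eq_zero {ι : Type*} {g : ι → ℝ} {b : ℝ} (h : ∀ i, g i = 0) (hb : b = 0) :
    HasSum g b := by
  rw [hb]
  exact hasSum_zero.congr_fun h

theorem hasSum_cons_iff {k : ℕ} {f : (Fin (k + 1) → ℤ) → ℝ} {a : ℝ} :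
    HasSum (fun z : ℤ × (Fin k → ℤ) => f (Fin.cons z.1 z.2)) a ↔ HasSum f a :=
  (Fin.consEquiv fun _ : Fin (k + 1) => ℤ).hasSum_iff

theorem hasSum_snoc_iff {k : ℕ} {f : (Fin (k + 1) → ℤ) → ℝ} {a : ℝ} :
    HasSum (fun z : ℤ × (Fin k → ℤ) => f (Fin.snoc z.2 z.1)) a ↔ HasSum f a :=
  (Fin.snocEquiv fun _ : Fin (k + 1) => ℤ).hasSum_iff

theorem hasSum_intRight_zero_mul (hq0 : 0 < q) (hq1 : q < 1) {x x' : ℤ} (hx : 0 ≤ x) (hx' : 0 ≤ x')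
    (n : Fin 2 → ℤ) (r s : Fin 0 → ℤ) :
    HasSum (fun m => intRight q 0 x n r m * intRight q 0 x' n s m) (if x = x' then 1 else 0) := by
  have h := hasSum_clebsch_leaf hq0 hq1 hx hx' (n 1 - n 0)
  let j : ℤ → Fin 2 → ℤ := fun m => ![m, m + (n 1 - n 0)]
  have hj : Function.Injective j := fun a b hab => congrFun hab 0
  refine (hj.hasSum_iff fun m hm => ?_).1 (h.congr_fun fun m => ?_)
  · have : ¬ m 1 - m 0 = n 1 - n 0 := by
      intro he
      refine hm ⟨m 0, ?_⟩
      funext i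
      fin_cases i
      · rfl
      · simp only [j, ← he]
        simp
    simp [intRight, this]
  · simp [intRight, j]

/-- With the first coordinate fixed, the subtree has norm `1` unless its root is negative, in which
case the Clebsch-Gordan factor vanishes anyway. -/
theorem hasSum_intRight_sq (hq0 : 0 < q) (hq1 : q < 1) (k : ℕ) {x : ℤ} (hx : 0 ≤ x)
    (n : Fin (k + 2) → ℤ) (r : Fin k → ℤ) : HasSum (fun m => intRight q k x n r m ^ 2) 1 := by
  induction k generalizing x with
  | zero =>
    simpa only [pow_two, if_true] using hasSum_intRight_zero_mul hq0 hq1 hx hx n r r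
  | succ k ih =>
    rw [← hasSum_cons_iff]
    have h := hasSum_clebsch_leaf hq0 hq1 hx hx (r 0 - n 0)
    rw [if_pos rfl] at h
    refine hasSum_prod_of_nonneg (fun _ => sq_nonneg _) (fun m => ?_) h
    rcases lt_or_ge (m + (r 0 - n 0)) 0 with h0 | h0
    · refine hasSum_of_eq_zero (fun z => ?_) ?_
      · rw [intRight_cons, clebsch_of_neg_right h0]; ring
      · rw [clebsch_of_neg_right h0, zero_mul]
    · refine hasSum_const_mul (ih h0 (Fin.tail n + Pi.single 0 (m - n 0)) (Fin.tail r))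
        (c := clebsch q x m (m + (r 0 - n 0)) ^ 2) (fun z => ?_) (by ring)
      rw [intRight_cons, mul_pow]

theorem hasSum_clebsch_leaf' (hq0 : 0 < q) (hq1 : q < 1) {x x' : ℤ} (hx : 0 ≤ x) (hx' : 0 ≤ x')
    (p : ℤ) : HasSum (fun m : ℤ => clebsch q x (m + p) m * clebsch q x' (m + p) m)
      (if x = x' then 1 else 0) := by
  simpa only [clebsch_comm] using hasSum_clebsch_leaf hq0 hq1 hx hx' p

theorem hasSum_intLeft_sq (hq0 : 0 < q) (hq1 : q < 1) (k : ℕ) {x : ℤ} (hx : 0 ≤ x)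
    (n : Fin (k + 2) → ℤ) (s : Fin k → ℤ) : HasSum (fun m => intLeft q k x n s m ^ 2) 1 := by
  induction k generalizing x with
  | zero =>
    simpa only [pow_two, if_true] using! hasSum_intRight_zero_mul hq0 hq1 hx hx n s s
  | succ k ih =>
    rw [← hasSum_snoc_iff]
    have h := hasSum_clebsch_leaf' hq0 hq1 hx hx (s (Fin.last k) - n (Fin.last (k + 2)))
    rw [if_pos rfl] at h
    refine hasSum_prod_of_nonneg (fun _ => sq_nonneg _) (fun m => ?_) h
    rcases lt_or_ge (m + (s (Fin.last k) - n (Fin.last (k + 2)))) 0 with h0 | h0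
    · refine hasSum_of_eq_zero (fun z => ?_) ?_
      · rw [intLeft_snoc, clebsch_of_neg_left h0]; ring
      · rw [clebsch_of_neg_left h0, zero_mul]
    · refine hasSum_const_mul (ih h0 (Fin.init n + Pi.single (Fin.last (k + 1))
        (m - n (Fin.last (k + 2)))) (Fin.init s))
        (c := clebsch q x (m + (s (Fin.last k) - n (Fin.last (k + 2)))) m ^ 2)
        (fun z => ?_) (by ring)
      rw [intLeft_snoc, mul_pow]

/-- Different roots are allowed because the induction needs them: at a fixed last coordinate,
different top nodes `s_k` give subtrees with different roots. -/
theorem hasSum_intLeft_mul (hq0 : 0 < q) (hq1 : q < 1) (k : ℕ) {x x' : ℤ} (hx : 0 ≤ x)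
    (hx' : 0 ≤ x') (n : Fin (k + 2) → ℤ) (s s' : Fin k → ℤ) :
    HasSum (fun m => intLeft q k x n s m * intLeft q k x' n s' m)
      (if x = x' ∧ s = s' then 1 else 0) := by
  induction k generalizing x x' with
  | zero =>
    simpa only [Subsingleton.elim s s', and_true] using!
      hasSum_intRight_zero_mul hq0 hq1 hx hx' n s s'
  | succ k ih =>
    have hs : Summable fun m => intLeft q (k + 1) x n s m * intLeft q (k + 1) x' n s' m :=
      summable_mul_of_sq (hasSum_intLeft_sq hq0 hq1 _ hx n s).summable
        (hasSum_intLeft_sq hq0 hq1 _ hx' n s').summable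
    have hs' := hasSum_snoc_iff.2 hs.hasSum
    have hss : s = s' ↔ s (Fin.last k) = s' (Fin.last k) ∧ Fin.init s = Fin.init s' := by
      conv_lhs => rw [← Fin.snoc_init_self s, ← Fin.snoc_init_self s', Fin.snoc_inj]
      exact and_comm
    have hin : ∀ m : ℤ, HasSum (fun z : Fin (k + 2) → ℤ =>
        intLeft q (k + 1) x n s (Fin.snoc z m) * intLeft q (k + 1) x' n s' (Fin.snoc z m))
        (if s = s' then clebsch q x (m + (s (Fin.last k) - n (Fin.last (k + 2)))) m *
          clebsch q x' (m + (s (Fin.last k) - n (Fin.last (k + 2)))) m else 0) := by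
      intro m
      simp only [intLeft_snoc]
      set y := m + (s (Fin.last k) - n (Fin.last (k + 2))) with hy
      set y' := m + (s' (Fin.last k) - n (Fin.last (k + 2))) with hy'
      have hyy : y = y' ↔ s (Fin.last k) = s' (Fin.last k) := by omega
      rcases lt_or_ge y 0 with h0 | h0
      · exact hasSum_of_eq_zero (fun z => by rw [clebsch_of_neg_left h0]; ring)
          (by simp [clebsch_of_neg_left h0])
      rcases lt_or_ge y' 0 with h0' | h0'
      · refine hasSum_of_eq_zero (fun z => by rw [clebsch_of_neg_left h0']; ring) (if_neg ?_)
        intro h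
        have := (hss.1 h).1
        omega
      · refine hasSum_const_mul (ih h0 h0' (Fin.init n + Pi.single (Fin.last (k + 1))
          (m - n (Fin.last (k + 2)))) (Fin.init s) (Fin.init s'))
          (c := clebsch q x y m * clebsch q x' y' m) (fun z => by ring) ?_
        by_cases hs0 : s = s'
        · have hy0 := hyy.2 (hss.1 hs0).1
          rw [if_pos hs0, if_pos ⟨hy0, (hss.1 hs0).2⟩, mul_one, hy0]
        · rw [if_neg hs0, if_neg fun h => hs0 (hss.2 ⟨hyy.1 h.1, h.2⟩), mul_zero]
    have hout := hs'.prod_fiberwise hin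
    have hout' : HasSum (fun m : ℤ => if s = s' then
        clebsch q x (m + (s (Fin.last k) - n (Fin.last (k + 2)))) m *
        clebsch q x' (m + (s (Fin.last k) - n (Fin.last (k + 2)))) m else 0)
        (if x = x' ∧ s = s' then 1 else 0) := by
      by_cases hs0 : s = s'
      · simpa only [hs0, and_true, if_true] using
          hasSum_clebsch_leaf' hq0 hq1 hx hx' (s' (Fin.last k) - n (Fin.last (k + 2)))
      · simp [hs0, hasSum_zero]
    rw [← hout.unique hout']
    exact hs.hasSum

end QSU2

namespace QSU2

variable {q : ℝ}

/-! ### Recoupling at the root -/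

/-- A left tree with its lowest node contracted. -/
theorem intLeft_succ (k : ℕ) (x : ℤ) (n : Fin (k + 3) → ℤ) (s : Fin (k + 1) → ℤ)
    (m : Fin (k + 3) → ℤ) :
    intLeft q (k + 1) x n s m =
      clebsch q (s 0 + (m 1 - m 0 - (n 1 - n 0))) (m 0) (m 1) *
        intLeft q k x (Fin.cons (s 0) (Fin.tail (Fin.tail n))) (Fin.tail s)
          (Fin.cons (s 0 + (m 1 - m 0 - (n 1 - n 0))) (Fin.tail (Fin.tail m))) := by
  induction k generalizing x with
  | zero =>
    have e1 : (Fin.init n + Pi.single (Fin.last 1) (m 2 - n 2) : Fin 2 → ℤ) 1 = n 1 + (m 2 - n 2) :=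
      by simp [Fin.init]
    have e0 : (Fin.init n + Pi.single (Fin.last 1) (m 2 - n 2) : Fin 2 → ℤ) 0 = n 0 := by
      simp [Fin.init]
    change clebsch q x (s 0 + (m 2 - n 2)) (m 2) *
      (if m 1 - m 0 = (Fin.init n + Pi.single (Fin.last 1) (m 2 - n 2) : Fin 2 → ℤ) 1 -
        (Fin.init n + Pi.single (Fin.last 1) (m 2 - n 2) : Fin 2 → ℤ) 0
        then clebsch q (s 0 + (m 2 - n 2)) (m 0) (m 1) else 0) =
      clebsch q (s 0 + (m 1 - m 0 - (n 1 - n 0))) (m 0) (m 1) *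
      (if m 2 - (s 0 + (m 1 - m 0 - (n 1 - n 0))) = n 2 - s 0
        then clebsch q x (s 0 + (m 1 - m 0 - (n 1 - n 0))) (m 2) else 0)
    rw [e1, e0]
    -- The shift applied to the subtree can be read off from its own leaves or from the last leaf;
    -- on the support the two values agree.
    by_cases h : m 1 - m 0 - (n 1 - n 0) = m 2 - n 2
    · rw [if_pos (by omega), if_pos (by omega), h, mul_comm]
    · rw [if_neg (by omega), if_neg (by omega), mul_zero, mul_zero]
  | succ k ih =>
    set a := s 0 + (m 1 - m 0 - (n 1 - n 0)) with ha
    set t := m (Fin.last (k + 3)) - n (Fin.last (k + 3)) with ht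
    obtain ⟨N, hN⟩ : ∃ N : Fin (k + 3) → ℤ, N = Fin.init n + Pi.single (Fin.last (k + 2)) t :=
      ⟨_, rfl⟩
    obtain ⟨S, hS⟩ : ∃ S : Fin (k + 1) → ℤ, S = Fin.init s := ⟨_, rfl⟩
    obtain ⟨M, hM⟩ : ∃ M : Fin (k + 3) → ℤ, M = Fin.init m := ⟨_, rfl⟩
    have hn0 : N 0 = n 0 := by
      simp [hN, Fin.init, Fin.ext_iff]
    have hn1 : N 1 = n 1 := by
      simp [hN, Fin.init, Fin.ext_iff]
    have hs0 : S 0 = s 0 := by rw [hS]; rfl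
    have hm0 : M 0 = m 0 := by rw [hM]; rfl
    have hm1 : M 1 = m 1 := by rw [hM]; rfl
    have h := ih (s (Fin.last (k + 1)) + t) N S M
    rw [hn0, hn1, hs0, hm0, hm1, ← ha] at h
    have h1 : (Fin.cons (s 0) (Fin.tail (Fin.tail N)) : Fin (k + 2) → ℤ) =
        Fin.init (Fin.cons (s 0) (Fin.tail (Fin.tail n)) : Fin (k + 3) → ℤ) +
          Pi.single (Fin.last (k + 1)) t := by
      funext i
      refine Fin.cases ?_ (fun j => ?_) i
      · simp [Fin.init, Fin.ext_iff]
      · simp only [hN, Fin.cons_succ, Fin.tail, Fin.init, Pi.add_apply, Pi.single_apply,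
          ← Fin.succ_castSucc, Fin.ext_iff, Fin.val_succ, Fin.val_last]
        congr 1
        exact if_congr (by omega) rfl rfl
    have h2 : (Fin.cons a (Fin.tail (Fin.tail M)) : Fin (k + 2) → ℤ) =
        Fin.init (Fin.cons a (Fin.tail (Fin.tail m)) : Fin (k + 3) → ℤ) := by
      funext i
      refine Fin.cases ?_ (fun j => ?_) i
      · rfl
      · rw [hM]; rfl
    have h3 : Fin.tail S = Fin.init (Fin.tail s) := by rw [hS]; rfl
    rw [h1, h2, h3, hN, hS, hM] at h
    rw [intLeft, h, intLeft]
    exact mul_left_comm _ _ _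

/-- The right child of the root of a right tree with all leaves but the first one given by `n`. -/
def rightChild (k : ℕ) (n : Fin (k + 1) → ℤ) (r : Fin k → ℤ) : ℤ :=
  (Fin.snoc r (n (Fin.last k)) : Fin (k + 1) → ℤ) 0

/-- The vector of the subtree at the right child, raised by `t`. -/
noncomputable def rightSubtree (q : ℝ) :
    (k : ℕ) → (Fin (k + 1) → ℤ) → (Fin k → ℤ) → ℤ → (Fin (k + 1) → ℤ) → ℝ
  | 0, n, _, t, m => if m 0 = n 0 + t then 1 else 0
  | k + 1, n, r, t, m => intRight q k (r 0 + t) (n + Pi.single 0 t) (Fin.tail r) m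

theorem intRight_eq (k : ℕ) (x : ℤ) (n : Fin (k + 2) → ℤ) (r : Fin k → ℤ)
    (m : Fin (k + 2) → ℤ) :
    intRight q k x n r m =
      clebsch q x (m 0) (rightChild k (Fin.tail n) r + (m 0 - n 0)) *
        rightSubtree q k (Fin.tail n) r (m 0 - n 0) (Fin.tail m) := by
  cases k with
  | zero =>
    change (if m 1 - m 0 = n 1 - n 0 then clebsch q x (m 0) (m 1) else 0) =
      clebsch q x (m 0) (n 1 + (m 0 - n 0)) * (if m 1 = n 1 + (m 0 - n 0) then 1 else 0)
    by_cases h : m 1 = n 1 + (m 0 - n 0)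
    · rw [if_pos h, if_pos (by omega), mul_one, h]
    · rw [if_neg h, if_neg (by omega), mul_zero]
  | succ k => rfl

/-- Coordinates adapted to the contraction of the first two leaves. -/
def contractEquiv (k : ℕ) (b : ℤ) : (Fin (k + 2) → ℤ) × ℤ ≃ (Fin (k + 3) → ℤ) where
  toFun z := Fin.cons z.2 (Fin.cons (z.2 + (z.1 0 + b)) (Fin.tail z.1))
  invFun m := (Fin.cons (m 1 - m 0 - b) (Fin.tail (Fin.tail m)), m 0)
  left_inv z := by
    refine Prod.ext ?_ rfl
    funext i
    refine Fin.cases ?_ (fun j => rfl) i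
    change z.2 + (z.1 0 + b) - z.2 - b = z.1 0
    ring
  right_inv m := by
    funext i
    refine Fin.cases rfl (fun j => ?_) i
    refine Fin.cases ?_ (fun j => rfl) j
    change m 0 + (m 1 - m 0 - b + b) = m 1
    ring

/-- The inner product of a right and a left tree vector. -/
noncomputable def treeInner (q : ℝ) (k : ℕ) (x : ℤ) (n : Fin (k + 2) → ℤ) (r s : Fin k → ℤ) : ℝ :=
  ∑' m : Fin (k + 2) → ℤ, intRight q k x n r m * intLeft q k x n s m

theorem summable_treeInner (hq0 : 0 < q) (hq1 : q < 1) (k : ℕ) {x : ℤ} (hx : 0 ≤ x)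
    (n : Fin (k + 2) → ℤ) (r s : Fin k → ℤ) :
    Summable fun m : Fin (k + 2) → ℤ => intRight q k x n r m * intLeft q k x n s m :=
  summable_mul_of_sq (hasSum_intRight_sq hq0 hq1 k hx n r).summable
    (hasSum_intLeft_sq hq0 hq1 k hx n s).summable

theorem treeInner_zero (hq0 : 0 < q) (hq1 : q < 1) {x : ℤ} (hx : 0 ≤ x) (n : Fin 2 → ℤ)
    (r s : Fin 0 → ℤ) : treeInner q 0 x n r s = 1 := by
  have := (hasSum_intRight_zero_mul hq0 hq1 hx hx n r s).tsum_eq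
  rwa [if_pos rfl] at this

/-- In these coordinates `w 0` is the label at the lowest left node and `l` the first leaf. Only the
last bracket depends on `l`, and its sum over `l` is a coupling sum. -/
theorem intRight_mul_intLeft_contract (k : ℕ) (x : ℤ) (n : Fin (k + 3) → ℤ)
    (r s : Fin (k + 1) → ℤ) (w : Fin (k + 2) → ℤ) (l : ℤ) :
    intRight q (k + 1) x n r (contractEquiv k (n 1 - n 0 - s 0) (w, l)) *
        intLeft q (k + 1) x n s (contractEquiv k (n 1 - n 0 - s 0) (w, l)) =
      rightSubtree q k (Fin.tail (Fin.tail n)) (Fin.tail r) (w 0 - s 0) (Fin.tail w) *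
        intLeft q k x (Fin.cons (s 0) (Fin.tail (Fin.tail n))) (Fin.tail s) w *
        (clebsch q x l (l + (r 0 - n 0)) *
          clebsch q (l + (r 0 - n 0)) (l + (w 0 + (n 1 - n 0 - s 0)))
            (rightChild k (Fin.tail (Fin.tail n)) (Fin.tail r) + (w 0 - s 0)) *
          clebsch q (w 0) l (l + (w 0 + (n 1 - n 0 - s 0)))) := by
  set M := contractEquiv k (n 1 - n 0 - s 0) (w, l) with hM
  have hM0 : M 0 = l := rfl
  have hM1 : M 1 = l + (w 0 + (n 1 - n 0 - s 0)) := rfl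
  have hM2 : Fin.tail (Fin.tail M) = Fin.tail w := rfl
  have ha : s 0 + (M 1 - M 0 - (n 1 - n 0)) = w 0 := by rw [hM1, hM0]; ring
  have hR : intRight q (k + 1) x n r M = clebsch q x l (l + (r 0 - n 0)) *
      intRight q k (l + (r 0 - n 0)) (Fin.tail n + Pi.single 0 (l - n 0)) (Fin.tail r)
        (Fin.tail M) := by
    rw [← intRight_cons]
    congr 1
  have hT : Fin.tail (Fin.tail n + Pi.single 0 (l - n 0) : Fin (k + 2) → ℤ) =
      Fin.tail (Fin.tail n) := by
    funext i
    simp [Fin.tail]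
  have h0 : (Fin.tail n + Pi.single 0 (l - n 0) : Fin (k + 2) → ℤ) 0 = n 1 + (l - n 0) := by
    simp [Fin.tail]
  have hM1' : Fin.tail M 0 = l + (w 0 + (n 1 - n 0 - s 0)) := rfl
  rw [hR, intRight_eq, intLeft_succ, ha, hM2, hT, h0, hM1', hM0, hM1, Fin.cons_self_tail,
    show l + (w 0 + (n 1 - n 0 - s 0)) - (n 1 + (l - n 0)) = w 0 - s 0 by ring]
  ring

/-- The constant is kept abstract so that the case of three leaves can be used to identify it. Once
the sum over `l` is replaced, `C_{x,a,c}` and the untouched subtree reassemble to a right tree with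
first leaf `s 0`. -/
theorem treeInner_succ_of_coupling (hq0 : 0 < q) (hq1 : q < 1) (k : ℕ) {x : ℤ} (hx : 0 ≤ x)
    (n : Fin (k + 3) → ℤ) (r s : Fin (k + 1) → ℤ) {l : ℝ}
    (hl : ∀ a c : ℤ, c - a = rightChild k (Fin.tail (Fin.tail n)) (Fin.tail r) - s 0 →
      coupling q x (r 0 - n 0) a c
        (c + (n 1 - n 0 - rightChild k (Fin.tail (Fin.tail n)) (Fin.tail r))) =
        l * clebsch q x a c) :
    treeInner q (k + 1) x n r s =
      l * treeInner q k x (Fin.cons (s 0) (Fin.tail (Fin.tail n))) (Fin.tail r) (Fin.tail s) := by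
  have hs := summable_treeInner hq0 hq1 (k + 1) hx n r s
  rw [treeInner, treeInner, ← (contractEquiv k (n 1 - n 0 - s 0)).tsum_eq, ← tsum_mul_left]
  have hs' := (contractEquiv k (n 1 - n 0 - s 0)).summable_iff.2 hs
  simp only [Function.comp_def] at hs'
  rw [hs'.tsum_prod]
  refine tsum_congr fun w => ?_
  simp only [intRight_mul_intLeft_contract]
  rw [tsum_mul_left]
  have h := hl (w 0) (rightChild k (Fin.tail (Fin.tail n)) (Fin.tail r) + (w 0 - s 0)) (by ring)
  rw [show rightChild k (Fin.tail (Fin.tail n)) (Fin.tail r) + (w 0 - s 0) +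
    (n 1 - n 0 - rightChild k (Fin.tail (Fin.tail n)) (Fin.tail r)) =
    w 0 + (n 1 - n 0 - s 0) by ring, coupling] at h
  rw [h, intRight_eq k x _ (Fin.tail r) w]
  simp only [Fin.tail_cons, Fin.cons_zero]
  ring

/-! ### Identification with `6j`-symbols and the product formula -/

theorem treeInner_eq_tsum (k : ℕ) (x : ℤ) (n : Fin (k + 2) → ℤ) (r s : Fin k → ℤ) :
    ∑' m : Fin (k + 2) → ℕ, treeRight q k x n r m * treeLeft q k x n s m =
      treeInner q k x n r s := by
  rw [treeInner, ← tsum_natCast fun m i h => by rw [intRight_of_neg k x n r m i h, zero_mul]]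
  simp only [intRight_natCast, intLeft_natCast]

theorem sixJ_eq_treeInner {x : ℤ} (hx : 0 ≤ x) (n : Fin 3 → ℤ) (r s : Fin 1 → ℤ) :
    sixJ q x (n 0) (n 1) (n 2) (r 0) (s 0) = treeInner q 1 x n r s := by
  rw [← treeInner_eq_tsum, sixJ, racah]
  refine tsum_congr fun m => ?_
  rw [Int.toNat_of_nonneg hx]
  congr 1
  · have e1 : (Fin.tail n + Pi.single 0 ((m 0 : ℤ) - n 0) : Fin 2 → ℤ) 1 = n 2 := by
      simp [Fin.tail]
    have e0 : (Fin.tail n + Pi.single 0 ((m 0 : ℤ) - n 0) : Fin 2 → ℤ) 0 =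
        n 1 + ((m 0 : ℤ) - n 0) := by
      simp [Fin.tail]
    change _ = clebsch q x (m 0) (r 0 + ((m 0 : ℤ) - n 0)) *
      (if (m 2 : ℤ) - m 1 = (Fin.tail n + Pi.single 0 ((m 0 : ℤ) - n 0) : Fin 2 → ℤ) 1 -
        (Fin.tail n + Pi.single 0 ((m 0 : ℤ) - n 0) : Fin 2 → ℤ) 0
        then clebsch q (r 0 + ((m 0 : ℤ) - n 0)) (m 1) (m 2) else 0)
    rw [e1, e0, vecRight, show (m 0 : ℤ) + (r 0 - n 0) = r 0 + ((m 0 : ℤ) - n 0) by ring, mul_ite,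
      mul_zero]
    exact if_congr (by omega) rfl rfl
  · have e1 : (Fin.init n + Pi.single (Fin.last 1) ((m 2 : ℤ) - n 2) : Fin 2 → ℤ) 1 =
        n 1 + ((m 2 : ℤ) - n 2) := by
      simp [Fin.init]
    have e0 : (Fin.init n + Pi.single (Fin.last 1) ((m 2 : ℤ) - n 2) : Fin 2 → ℤ) 0 = n 0 := by
      simp [Fin.init]
    change _ = clebsch q x (s 0 + ((m 2 : ℤ) - n 2)) (m 2) *
      (if (m 1 : ℤ) - m 0 = (Fin.init n + Pi.single (Fin.last 1) ((m 2 : ℤ) - n 2) : Fin 2 → ℤ) 1 -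
        (Fin.init n + Pi.single (Fin.last 1) ((m 2 : ℤ) - n 2) : Fin 2 → ℤ) 0
        then clebsch q (s 0 + ((m 2 : ℤ) - n 2)) (m 0) (m 1) else 0)
    rw [e1, e0, vecLeft, show (m 2 : ℤ) - (n 2 - s 0) = s 0 + ((m 2 : ℤ) - n 2) by ring, mul_ite,
      mul_zero]
    exact if_congr (by omega) rfl rfl

/-- Contracting a tree with three leaves leaves an inner product of two equal unit vectors, so the
proportionality constant is the inner product of the three-leaf trees. -/
theorem coupling_eq_sixJ (hq0 : 0 < q) (hq1 : q < 1) {x : ℤ} (hx : 0 ≤ x) (n₁ n₂ n₃ r s : ℤ)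
    {a c : ℤ} (hac : c - a = n₃ - s) :
    coupling q x (r - n₁) a c (c + (n₂ - n₁ - n₃)) = sixJ q x n₁ n₂ n₃ r s * clebsch q x a c := by
  obtain ⟨l, hl⟩ := exists_coupling_eq hq0 hq1 hx (r - n₁) (n₂ - n₁ - n₃) (n₃ - s)
  have h := treeInner_succ_of_coupling hq0 hq1 0 hx ![n₁, n₂, n₃] ![r] ![s] (l := l)
    fun a c hac => hl a c hac
  rw [treeInner_zero hq0 hq1 hx, mul_one] at h
  have h6 := sixJ_eq_treeInner (q := q) hx ![n₁, n₂, n₃] ![r] ![s]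
  rw [hl a c hac, ← h, ← h6]
  rfl

theorem treeInner_succ (hq0 : 0 < q) (hq1 : q < 1) (k : ℕ) {x : ℤ} (hx : 0 ≤ x)
    (n : Fin (k + 3) → ℤ) (r s : Fin (k + 1) → ℤ) :
    treeInner q (k + 1) x n r s =
      sixJ q x (n 0) (n 1) (rightChild k (Fin.tail (Fin.tail n)) (Fin.tail r)) (r 0) (s 0) *
      treeInner q k x (Fin.cons (s 0) (Fin.tail (Fin.tail n))) (Fin.tail r) (Fin.tail s) :=
  treeInner_succ_of_coupling hq0 hq1 k hx n r s fun _ _ h => coupling_eq_sixJ hq0 hq1 hx _ _ _ _ _ h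

theorem treeInner_eq_prod (hq0 : 0 < q) (hq1 : q < 1) (k : ℕ) {x : ℤ} (hx : 0 ≤ x)
    (n : Fin (k + 2) → ℤ) (r s : Fin k → ℤ) :
    treeInner q k x n r s = ∏ j : Fin k,
      sixJ q x ((Fin.cons (n 0) s : Fin (k + 1) → ℤ) j.castSucc) (n j.succ.castSucc)
        ((Fin.snoc r (n (Fin.last (k + 1))) : Fin (k + 1) → ℤ) j.succ) (r j) (s j) := by
  induction k with
  | zero => rw [treeInner_zero hq0 hq1 hx]; rfl
  | succ k ih =>
    have hsnoc : ∀ i : Fin (k + 1), (Fin.snoc r (n (Fin.last (k + 2))) : Fin (k + 2) → ℤ) i.succ =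
        (Fin.snoc (Fin.tail r) (n (Fin.last (k + 2))) : Fin (k + 1) → ℤ) i := by
      intro i
      refine Fin.lastCases ?_ (fun j => ?_) i
      · rw [Fin.succ_last, Fin.snoc_last, Fin.snoc_last]
      · rw [Fin.succ_castSucc, Fin.snoc_castSucc, Fin.snoc_castSucc]
        rfl
    rw [treeInner_succ hq0 hq1 k hx, ih, Fin.prod_univ_succ]
    simp only [hsnoc]
    congr 1
    refine Finset.prod_congr rfl fun j _ => ?_
    congr 1
    change (Fin.cons (s 0) (Fin.tail s) : Fin (k + 1) → ℤ) j.castSucc = s j.castSucc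
    rw [Fin.cons_self_tail]

end QSU2

namespace QSU2

variable {q : ℝ}

/-! ### Completeness -/

/-- For fixed `c`, passing from the summand in `n` to the coupling sum in `a` preserves the norm. So
the squares of all coupling sums add up to the squared norm of a right-coupled vector, which is `1`;
grouped by `s`, they are `6j`-squares times `∑_a C_{x,a,c}² = 1`. -/
theorem hasSum_sixJ_sq (hq0 : 0 < q) (hq1 : q < 1) {x : ℤ} (hx : 0 ≤ x) (n₁ n₂ n₃ r : ℤ) :
    HasSum (fun s : ℤ => sixJ q x n₁ n₂ n₃ r s ^ 2) 1 := by
  set p := r - n₁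
  set e := n₂ - n₁ - n₃ with he
  have h1 : HasSum (fun z : ℤ × ℤ =>
      (clebsch q x z.1 (z.1 + p) * clebsch q (z.1 + p) (z.1 + (z.2 + e)) z.2) ^ 2) 1 := by
    have h := hasSum_clebsch_leaf hq0 hq1 hx hx p
    rw [if_pos rfl] at h
    refine hasSum_prod_of_nonneg (fun _ => sq_nonneg _) (fun n => ?_) h
    rcases lt_or_ge (n + p) 0 with h0 | h0
    · exact hasSum_of_eq_zero (fun c => by rw [clebsch_of_neg_right h0]; ring)
        (by rw [clebsch_of_neg_right h0, zero_mul])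
    · have h' := hasSum_clebsch_leaf' hq0 hq1 h0 h0 (n + e)
      rw [if_pos rfl] at h'
      refine hasSum_const_mul h' (c := clebsch q x n (n + p) ^ 2) (fun c => ?_) (by ring)
      rw [show n + (c + e) = c + (n + e) by ring]
      ring
  have h2 := (Equiv.prodComm ℤ ℤ).hasSum_iff.2 h1
  have h3 : HasSum (fun z : ℤ × ℤ => coupling q x p z.2 z.1 (z.1 + e) ^ 2) 1 := by
    refine hasSum_prod_of_nonneg (fun _ => sq_nonneg _) (fun c => ?_)
      (h2.prod_fiberwise fun c => (h2.summable.prod_factor c).hasSum)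
    set h : ℤ → ℝ := fun n => clebsch q x n (n + p) * clebsch q (n + p) (n + (c + e)) c with hh
    have hz : ∀ n, (n < 0 ∨ n + (c + e) < 0) → h n = 0 := by
      rintro n (h0 | h0)
      · simp [hh, clebsch_of_neg_left h0]
      · simp [hh, clebsch_of_neg_left h0]
    have hsum : Summable fun n => h n ^ 2 := h2.summable.prod_factor c
    have hsub : HasSum (fun n : leafIndex (c + e) => h n ^ 2) (∑' n, h n ^ 2) :=
      (hasSum_subtype_iff_of_support_subset (f := fun n => h n ^ 2)
        (support_subset_index fun n hn => by rw [hz n hn]; norm_num)).2 hsum.hasSum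
    have hexp := (orthonormal_expansion (hasSum_clebsch_index hq0 hq1 (c + e))
      hsub.summable).1
    rw [hsub.tsum_eq] at hexp
    refine hexp.congr_fun fun a => ?_
    rw [coupling]
    congr 1
    exact (tsum_subtype_eq_of_support_subset (f := fun n => h n * clebsch q a n (n + (c + e)))
      (support_subset_index fun n hn => by rw [hz n hn, zero_mul])).symm
  -- Sends `(s, a)` to `(c, a)` with `c - a = n₃ - s`, the lines on which the recoupling constant is
  -- fixed.
  let E : ℤ × ℤ ≃ ℤ × ℤ :=
    { toFun := fun z => (z.2 + (n₃ - z.1), z.2)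
      invFun := fun z => (z.2 + n₃ - z.1, z.2)
      left_inv := fun z => Prod.ext (by simp only; ring) rfl
      right_inv := fun z => Prod.ext (by simp only; ring) rfl }
  have h4 := E.hasSum_iff.2 h3
  refine h4.prod_fiberwise fun s => ?_
  have h := hasSum_clebsch_leaf hq0 hq1 hx hx (n₃ - s)
  rw [if_pos rfl] at h
  refine hasSum_const_mul h (c := sixJ q x n₁ n₂ n₃ r s ^ 2) (fun a => ?_) (by ring)
  change coupling q x p a (a + (n₃ - s)) (a + (n₃ - s) + e) ^ 2 = _
  rw [coupling_eq_sixJ hq0 hq1 hx n₁ n₂ n₃ r s (by ring)]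
  ring

theorem hasSum_treeInner_sq (hq0 : 0 < q) (hq1 : q < 1) (k : ℕ) {x : ℤ} (hx : 0 ≤ x)
    (n : Fin (k + 2) → ℤ) (r : Fin k → ℤ) :
    HasSum (fun s : Fin k → ℤ => treeInner q k x n r s ^ 2) 1 := by
  induction k with
  | zero =>
    simp only [treeInner_zero hq0 hq1 hx, one_pow]
    exact hasSum_unique fun _ : Fin 0 → ℤ => (1 : ℝ)
  | succ k ih =>
    rw [← hasSum_cons_iff]
    refine hasSum_prod_of_nonneg (fun _ => sq_nonneg _) (fun s => ?_)
      (hasSum_sixJ_sq hq0 hq1 hx (n 0) (n 1)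
        (rightChild k (Fin.tail (Fin.tail n)) (Fin.tail r)) (r 0))
    refine hasSum_const_mul (ih (Fin.cons s (Fin.tail (Fin.tail n))) (Fin.tail r))
      (c := sixJ q x (n 0) (n 1) (rightChild k (Fin.tail (Fin.tail n)) (Fin.tail r)) (r 0) s ^ 2)
      (fun s' => ?_) (by ring)
    rw [treeInner_succ hq0 hq1 k hx, Fin.cons_zero, Fin.tail_cons, mul_pow]

/-! ### The `3nj`-symbols -/

theorem threeNJ_eq_treeInner (k : ℕ) (x : ℤ) (n : Fin (k + 2) → ℤ) (r s : Fin k → ℤ) :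
    threeNJ q k x n r s = treeInner q k x.toNat (raiseInner k (x - x.toNat) n) r s :=
  treeInner_eq_tsum _ _ _ _ _

theorem threeNJ_of_nonneg (k : ℕ) {x : ℤ} (hx : 0 ≤ x) (n : Fin (k + 2) → ℤ) (r s : Fin k → ℤ) :
    threeNJ q k x n r s = treeInner q k x n r s := by
  rw [threeNJ_eq_treeInner, Int.toNat_of_nonneg hx, sub_self]
  congr 1
  funext j
  simp [raiseInner]

/-- The symbol involves `x` and `n₂` only through `x.toNat` and `x + n₂`. In the product formula
every middle leaf is an inner leaf, so this absorbs the shift made for negative roots. -/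
theorem sixJ_toNat (x n₁ n₂ n₃ p₁ p₂ : ℤ) :
    sixJ q x.toNat n₁ (n₂ + (x - x.toNat)) n₃ p₁ p₂ = sixJ q x n₁ n₂ n₃ p₁ p₂ := by
  rw [sixJ, sixJ, Int.toNat_natCast,
    show (x.toNat : ℤ) - n₁ + (n₂ + (x - x.toNat)) - n₃ = x - n₁ + n₂ - n₃ by ring]

theorem threeNJ_eq_prod (hq0 : 0 < q) (hq1 : q < 1) (k : ℕ) (x : ℤ) (n : Fin (k + 2) → ℤ)
    (r s : Fin k → ℤ) :
    threeNJ q k x n r s = ∏ j : Fin k,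
      sixJ q x ((Fin.cons (n 0) s : Fin (k + 1) → ℤ) j.castSucc) (n j.succ.castSucc)
        ((Fin.snoc r (n (Fin.last (k + 1))) : Fin (k + 1) → ℤ) j.succ) (r j) (s j) := by
  rw [threeNJ_eq_treeInner, treeInner_eq_prod hq0 hq1 k (by omega)]
  refine Finset.prod_congr rfl fun j _ => ?_
  have h0 : raiseInner k (x - x.toNat) n 0 = n 0 := by simp [raiseInner]
  have hl : raiseInner k (x - x.toNat) n (Fin.last (k + 1)) = n (Fin.last (k + 1)) := by
    simp [raiseInner]
  have hj : raiseInner k (x - x.toNat) n j.succ.castSucc =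
      n j.succ.castSucc + (x - x.toNat) := by
    have h1 : j.succ.castSucc ≠ 0 := by simp [Fin.ext_iff]
    have h2 : j.succ.castSucc ≠ Fin.last (k + 1) := by
      simp only [ne_eq, Fin.ext_iff, Fin.val_castSucc, Fin.val_succ, Fin.val_last]
      omega
    simp only [raiseInner, h1, h2, or_self, if_false]
  rw [h0, hl, hj, sixJ_toNat]

/-- The left trees are orthonormal, and the squared coefficients exhaust the norm of the unit right
tree vector. -/
theorem hasSum_threeNJ_smul (hq0 : 0 < q) (hq1 : q < 1) (k : ℕ) {x : ℤ} (hx : 0 ≤ x)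
    (n : Fin (k + 2) → ℤ) (hR : ∀ r : Fin k → ℤ, Memℓp (treeRight q k x n r) 2)
    (hL : ∀ s : Fin k → ℤ, Memℓp (treeLeft q k x n s) 2) (r : Fin k → ℤ) :
    HasSum (fun s : Fin k → ℤ => threeNJ q k x n r s •
      (⟨treeLeft q k x n s, hL s⟩ : lp (fun _ : Fin (k + 2) → ℕ => ℝ) 2))
      ⟨treeRight q k x n r, hR r⟩ := by
  refine hasSum_of_parseval (g := fun s => ⟨treeLeft q k x n s, hL s⟩)
    (v := ⟨treeRight q k x n r, hR r⟩) (fun s s' => ?_) (fun s => ?_) ?_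
  · have h := (hasSum_natCast_iff fun m i h => by
      rw [intLeft_of_neg k x n s m i h, zero_mul]).2 (hasSum_intLeft_mul hq0 hq1 k hx hx n s s')
    simpa only [intLeft_natCast, true_and] using h
  · have h := (hasSum_natCast_iff fun m i h => by
      rw [intRight_of_neg k x n r m i h, zero_mul]).2
        (summable_treeInner hq0 hq1 k hx n r s).hasSum
    rw [threeNJ_of_nonneg k hx, treeInner]
    simpa only [intRight_natCast, intLeft_natCast] using h
  · have h := (hasSum_natCast_iff fun m i h => by
      rw [intRight_of_neg k x n r m i h]; norm_num).2 (hasSum_intRight_sq hq0 hq1 k hx n r)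
    simp only [intRight_natCast] at h
    have hn : ‖(⟨treeRight q k x n r, hR r⟩ : lp (fun _ : Fin (k + 2) → ℕ => ℝ) 2)‖ ^ 2 = 1 := by
      rw [← real_inner_self_eq_norm_sq]
      refine (hasSum_inner_lp _ _).unique ?_
      simpa only [pow_two] using h
    rw [hn]
    simpa only [threeNJ_of_nonneg k hx] using hasSum_treeInner_sq hq0 hq1 k hx n r

theorem memℓp_treeRight (hq0 : 0 < q) (hq1 : q < 1) (k : ℕ) (x : ℤ) (n : Fin (k + 2) → ℤ)
    (r : Fin k → ℤ) : Memℓp (treeRight q k x n r) 2 := by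
  rw [memℓp_two_iff]
  simp only [← intRight_natCast]
  rcases lt_or_ge x 0 with hx | hx
  · simp [intRight_of_neg_root k hx, summable_zero]
  · exact ((hasSum_natCast_iff fun m i h => by
      rw [intRight_of_neg k x n r m i h]; norm_num).2
        (hasSum_intRight_sq hq0 hq1 k hx n r)).summable

theorem memℓp_treeLeft (hq0 : 0 < q) (hq1 : q < 1) (k : ℕ) (x : ℤ) (n : Fin (k + 2) → ℤ)
    (s : Fin k → ℤ) : Memℓp (treeLeft q k x n s) 2 := by
  rw [memℓp_two_iff]
  simp only [← intLeft_natCast]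
  rcases lt_or_ge x 0 with hx | hx
  · simp [intLeft_of_neg_root k hx, summable_zero]
  · exact ((hasSum_natCast_iff fun m i h => by
      rw [intLeft_of_neg k x n s m i h]; norm_num).2
        (hasSum_intLeft_sq hq0 hq1 k hx n s)).summable

theorem hasSum_threeNJ_smul_of_neg (k : ℕ) {x : ℤ} (hx : x < 0)
    (n : Fin (k + 2) → ℤ) (hR : ∀ r : Fin k → ℤ, Memℓp (treeRight q k x n r) 2)
    (hL : ∀ s : Fin k → ℤ, Memℓp (treeLeft q k x n s) 2) (r : Fin k → ℤ) :
    HasSum (fun s : Fin k → ℤ => threeNJ q k x n r s •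
      (⟨treeLeft q k x n s, hL s⟩ : lp (fun _ : Fin (k + 2) → ℕ => ℝ) 2))
      ⟨treeRight q k x n r, hR r⟩ := by
  have h1 : (⟨treeRight q k x n r, hR r⟩ : lp (fun _ : Fin (k + 2) → ℕ => ℝ) 2) = 0 := by
    ext m
    change treeRight q k x n r m = 0
    rw [← intRight_natCast, intRight_of_neg_root k hx]
  have h2 : ∀ s, (⟨treeLeft q k x n s, hL s⟩ : lp (fun _ : Fin (k + 2) → ℕ => ℝ) 2) = 0 := by
    intro s
    ext m
    change treeLeft q k x n s m = 0
    rw [← intLeft_natCast, intLeft_of_neg_root k hx]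
  rw [h1]
  simp only [h2, smul_zero]
  exact hasSum_zero

/-! ### Factorization -/

theorem cons_castSucc_eq {k : ℕ} (a : ℤ) (s : Fin k → ℤ) (i : Fin k) :
    (Fin.cons a s : Fin (k + 1) → ℤ) i.castSucc =
      if _h : (i : ℕ) = 0 then a else s ⟨i - 1, by omega⟩ := by
  obtain ⟨i, hi⟩ := i
  cases i with
  | zero => rfl
  | succ i => rfl

theorem snoc_succ_eq {k : ℕ} (b : ℤ) (r : Fin k → ℤ) (i : Fin k) :
    (Fin.snoc r b : Fin (k + 1) → ℤ) i.succ =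
      if h : (i : ℕ) + 1 < k then r ⟨i + 1, h⟩ else b := by
  split_ifs with h
  · exact Fin.snoc_castSucc (α := fun _ => ℤ) b r ⟨i + 1, h⟩
  · rw [show i.succ = Fin.last k from Fin.ext (by simp only [Fin.val_succ, Fin.val_last]; omega),
      Fin.snoc_last]

theorem append_of_lt {a b : ℕ} (f : Fin a → ℤ) (g : Fin b → ℤ) {i : ℕ} (h : i < a + b)
    (hi : i < a) : Fin.append f g ⟨i, h⟩ = f ⟨i, hi⟩ :=
  Fin.append_left f g ⟨i, hi⟩

theorem append_of_ge {a b : ℕ} (f : Fin a → ℤ) (g : Fin b → ℤ) {i : ℕ} (h : i < a + b)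
    (hi : a ≤ i) : Fin.append f g ⟨i, h⟩ = g ⟨i - a, by omega⟩ := by
  rw [← Fin.append_right f g ⟨i - a, by omega⟩]
  congr 1
  exact Fin.ext (by simp only [Fin.val_natAdd]; omega)

theorem joinLeaves_of_lt {k₁ k₂ : ℕ} (n₁ : Fin (k₁ + 1) → ℤ) (n₂ : Fin (k₂ + 1) → ℤ)
    (j : Fin (k₁ + k₂ + 2)) (h : (j : ℕ) < k₁ + 1) : joinLeaves n₁ n₂ j = n₁ ⟨j, h⟩ :=
  append_of_lt n₁ n₂ (by omega) h

theorem joinLeaves_of_ge {k₁ k₂ : ℕ} (n₁ : Fin (k₁ + 1) → ℤ) (n₂ : Fin (k₂ + 1) → ℤ)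
    (j : Fin (k₁ + k₂ + 2)) (h : k₁ + 1 ≤ (j : ℕ)) :
    joinLeaves n₁ n₂ j = n₂ ⟨j - (k₁ + 1), by omega⟩ :=
  append_of_ge n₁ n₂ (by omega) h

/-- All three symbols are products of `6j`-symbols. At the cut the first block needs `r_{k₁+1}` and
the second needs `s_{k₁}`, which are exactly the leaves appended to the smaller trees. -/
theorem threeNJ_join (hq0 : 0 < q) (hq1 : q < 1) (x : ℤ) (k₁ k₂ : ℕ) (h₁ : 1 ≤ k₁) (h₂ : 1 ≤ k₂)
    (n₁ : Fin (k₁ + 1) → ℤ) (n₂ : Fin (k₂ + 1) → ℤ) (r₁ s₁ : Fin k₁ → ℤ) (r₂ s₂ : Fin k₂ → ℤ) :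
    threeNJ q (k₁ + k₂) x (joinLeaves n₁ n₂) (Fin.append r₁ r₂) (Fin.append s₁ s₂) =
      threeNJ q k₁ x (Fin.snoc n₁ (r₂ ⟨0, h₂⟩)) r₁ s₁ *
        threeNJ q k₂ x (Fin.cons (s₁ ⟨k₁ - 1, Nat.sub_one_lt_of_lt h₁⟩) n₂) r₂ s₂ := by
  rw [threeNJ_eq_prod hq0 hq1, threeNJ_eq_prod hq0 hq1, threeNJ_eq_prod hq0 hq1,
    Fin.prod_univ_add]
  simp only [cons_castSucc_eq, snoc_succ_eq, Fin.append_left, Fin.append_right]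
  congr 1
  · refine Finset.prod_congr rfl fun i _ => ?_
    congr 1
    · simp only [Fin.val_castAdd]
      split_ifs with h
      · rw [joinLeaves_of_lt _ _ _ (by simp)]
        exact (Fin.snoc_castSucc (α := fun _ => ℤ) _ n₁ 0).symm
      · exact append_of_lt _ _ _ _
    · rw [joinLeaves_of_lt _ _ _ (by simp), Fin.snoc_castSucc]
      rfl
    · simp only [Fin.val_castAdd]
      rw [dif_pos (by omega)]
      -- In the last factor of the first block the next right label is the first entry of `r₂`.
      split_ifs with h
      · exact append_of_lt _ _ _ _
      · rw [append_of_ge _ _ _ (by omega), Fin.snoc_last]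
        congr 1
        exact Fin.ext (by simp only; omega)
  · refine Finset.prod_congr rfl fun i _ => ?_
    congr 1
    · simp only [Fin.val_natAdd]
      rw [dif_neg (by omega)]
      -- In the first factor of the second block the previous left label is the last entry of `s₁`.
      split_ifs with h
      · rw [append_of_lt _ _ _ (by omega)]
        simp only [h, add_zero]
        rfl
      · rw [append_of_ge _ _ _ (by omega)]
        congr 1
        exact Fin.ext (by simp only; omega)
    · rw [joinLeaves_of_ge _ _ _ (by
        simp only [Fin.val_castSucc, Fin.val_succ, Fin.val_natAdd]; omega)]
      change _ = n₂ i.castSucc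
      congr 1
      exact Fin.ext (by
        simp only [Fin.val_castSucc, Fin.val_succ, Fin.val_natAdd]; omega)
    · simp only [Fin.val_natAdd]
      by_cases h : (i : ℕ) + 1 < k₂
      · rw [dif_pos (by omega), dif_pos h, append_of_ge _ _ _ (by omega)]
        congr 1
        exact Fin.ext (by simp only; omega)
      · rw [dif_neg (by omega), dif_neg h, joinLeaves_of_ge _ _ _ (by
          simp only [Fin.val_last]; omega)]
        change _ = n₂ (Fin.last k₂)
        congr 1
        exact Fin.ext (by simp only [Fin.val_last]; omega)

end QSU2

theorem mainTheorem4 (q : ℝ) (hq0 : 0 < q) (hq1 : q < 1) (x : ℤ) :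
    -- the tree vectors lie in the Hilbert space, and the `3nj`-symbols are the coefficients of the
    -- first kind of tree with respect to the second kind
    (∀ (k : ℕ), 1 ≤ k → ∀ (n : Fin (k + 2) → ℤ),
      ∃ (hR : ∀ r : Fin k → ℤ, Memℓp (QSU2.treeRight q k x n r) 2)
        (hL : ∀ s : Fin k → ℤ, Memℓp (QSU2.treeLeft q k x n s) 2),
        ∀ r : Fin k → ℤ,
          HasSum
            (fun s : Fin k → ℤ => QSU2.threeNJ q k x n r s •
              (⟨QSU2.treeLeft q k x n s, hL s⟩ : lp (fun _ : Fin (k + 2) → ℕ => ℝ) 2))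
            ⟨QSU2.treeRight q k x n r, hR r⟩) ∧
    -- factorization
    (∀ (k₁ k₂ : ℕ) (h₁ : 1 ≤ k₁) (h₂ : 1 ≤ k₂)
      (n₁ : Fin (k₁ + 1) → ℤ) (n₂ : Fin (k₂ + 1) → ℤ)
      (r₁ s₁ : Fin k₁ → ℤ) (r₂ s₂ : Fin k₂ → ℤ),
      QSU2.threeNJ q (k₁ + k₂) x (QSU2.joinLeaves n₁ n₂) (Fin.append r₁ r₂) (Fin.append s₁ s₂) =
        QSU2.threeNJ q k₁ x (Fin.snoc n₁ (r₂ ⟨0, h₂⟩)) r₁ s₁ *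
          QSU2.threeNJ q k₂ x (Fin.cons (s₁ ⟨k₁ - 1, Nat.sub_one_lt_of_lt h₁⟩) n₂) r₂ s₂) ∧
    -- product of `6j`-symbols
    (∀ (k : ℕ), 1 ≤ k → ∀ (n : Fin (k + 2) → ℤ) (r s : Fin k → ℤ),
      QSU2.threeNJ q k x n r s =
        ∏ j : Fin k,
          QSU2.sixJ q x
            ((Fin.cons (n 0) s : Fin (k + 1) → ℤ) j.castSucc)
            (n j.succ.castSucc)
            ((Fin.snoc r (n (Fin.last (k + 1))) : Fin (k + 1) → ℤ) j.succ)
            (r j) (s j)) := by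
  refine ⟨fun k _ n => ⟨QSU2.memℓp_treeRight hq0 hq1 k x n, QSU2.memℓp_treeLeft hq0 hq1 k x n,
    fun r => ?_⟩, fun k₁ k₂ h₁ h₂ => QSU2.threeNJ_join hq0 hq1 x k₁ k₂ h₁ h₂,
    fun k _ => QSU2.threeNJ_eq_prod hq0 hq1 k x⟩
  rcases lt_or_ge x 0 with hx | hx
  · exact QSU2.hasSum_threeNJ_smul_of_neg k hx n _ _ r
  · exact QSU2.hasSum_threeNJ_smul hq0 hq1 k hx n _ _ r
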